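/- Let $G=\mathrm{PGL}_3(\mathbb R)$, let $U\subset G$ be the group of unipotent upper triangular matrices, $K=\mathrm{PO}(3)$, $S=G/K$, and let $A$ be the group of classes of positive diagonal matrices, with coordinates $(y_1,y_2)\in\mathbb R_{>0}^2$ given by the simple roots, so that $a=\mathrm{diag}(y_1y_2,y_2,1)$. Let $\mathsf w\in K$ be a lift of the long Weyl element and let $\mathrm H:G\to\mathfrak a$, $ue^Xk\mapsto X$, be the Iwasawa projection to the traceless diagonal matrices. For the self-dual parameter $H=\mathrm{diag}(1,0,-1)$ consider the Whittaker phase function $$F(u,x)=\mathrm{tr}\bigl(H\cdot \mathrm H(\mathsf w u g)\bigr)-(u_{12}+u_{23}),\qquad u\in U,\ x=gK\in S .$$ Let $\Lambda\subset T^*S$ be the set of all $(x,d_xF(u,x))$ with $d_uF(u,x)=0$, and let $\Lambda^{\rm red}=U\backslash\Lambda\subset T^*A$ be its reduction by $U$ (here $S\cong U\times A$ by the Iwasawa decomposition, and $T^*A$ is the symplectic reduction of $T^*S$ over the functional $u\mapsto u_{12}+u_{23}$). Let $\pi:\Lambda^{\rm red}\to A$ be the resulting Lagrangian mapping between surfaces,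 and $\mathscr F(a)=\pi^{-1}(a)$. A point $p\in\Lambda^{\rm red}$ is called degenerate (singular) if $d\pi_p$ is not of full rank, and non-degenerate otherwise. It is of fold type ($A_2$) if the germ of $\pi$ at $p$ is, up to smooth changes of coordinates in source and target, the germ at $0$ of $(s,t)\mapsto(s^2,t)$, and of cuspidal type ($A_3$) if it is that of $(s,t)\mapsto(s^3+st,t)$. The shadow zone is $\mathsf S=A\setminus\pi(\Lambda^{\rm red})$, the caustic $\mathsf C$ is the image under $\pi$ of the singular points, and the light zone is $\mathsf L=\pi(\Lambda^{\rm red})\setminus\mathsf C$. Put $P(y_1,y_2)=27y_1^4y_2^4-18y_1^2y_2^2+4y_2^2+4y_1^2$, let $a_{\rm cusp}\in A$ be the point $(1/\sqrt3,1/\sqrt3)$, and define the following subsets of $A=\{y_1,y_2>0\}$: $$\mathsf L_1=\{P<1\},\quad \mathsf L_2=\{P>1,\ y_1^2+y_2^2<1\},\quad \mathsf C_1=\{y_1^2+y_2^2=1\},\quad \mathsf C_2=\{P=1\}\setminus\{a_{\rm cusp}\}.$$ **Theorem.** We have $$\mathsf S=\{y_1^2+y_2^2>1\},\qquad \mathsf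 L=\mathsf L_1\sqcup\mathsf L_2,\qquad \mathsf C=\mathsf C_1\sqcup\{a_{\rm cusp}\}\sqcup\mathsf C_2 .$$ Moreover: 1. for all $a\in\mathsf L_1$ we have $|\mathscr F(a)|=6$; 2. for all $a\in\mathsf L_2$ we have $|\mathscr F(a)|=2$; 3. for all $a\in\mathsf C_1$ we have $|\mathscr F(a)|=1$, and the point is of fold type; 4. for all $a\in\mathsf C_2$ we have $|\mathscr F(a)|=4$; two of the points are non-degenerate, and two are degenerate of fold type; 5. $|\mathscr F(a_{\rm cusp})|=2$, and both points are of cuspidal type. -/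

import Mathlib

open scoped ContDiff Topology

namespace PGL3Whittaker

noncomputable section

/-! The group `PGL_3(ℝ)` is handled through invertible real `3 × 3` matrices up to scalars.
`U` is the group of unipotent upper triangular matrices, `A` the connected diagonal torus (modulo
scalars), `K` the orthogonal group (modulo scalars), `S = G / K`. -/

/-- Global coordinates `(u₁₂, u₂₃, u₁₃)` on `U`. -/
abbrev UCoord := ℝ × ℝ × ℝ

/-- Coordinates `(y₁, y₂) = (α₁(a), α₂(a))` on `A` given by the two simple roots; the torus itself
is the open quadrant `torus` below. -/
abbrev ACoord := ℝ × ℝ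

/-- The element of `U` with given coordinates. -/
def unip (v : UCoord) : Matrix (Fin 3) (Fin 3) ℝ :=
  !![1, v.1, v.2.2; 0, 1, v.2.1; 0, 0, 1]

/-- The element `diag(y₁ y₂, y₂, 1)` of `A`, whose simple roots are `y₁` and `y₂`. -/
def diagA (y : ACoord) : Matrix (Fin 3) (Fin 3) ℝ :=
  Matrix.diagonal ![y.1 * y.2, y.2, 1]

/-- `A` in root coordinates. -/
def torus : Set ACoord := {y | 0 < y.1 ∧ 0 < y.2}

/-- A lift to `K` of the long Weyl group element. -/
def longWeyl : Matrix (Fin 3) (Fin 3) ℝ :=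
  !![0, 0, 1; 0, 1, 0; 1, 0, 0]

/-- The Iwasawa projection `G → 𝔞`, `u e^X k ↦ X`, with `𝔞` the traceless diagonal matrices
(given by their diagonals). It is computed from the lower right minors of `g gᵀ`; see
`iwasawaProj_eq` for its characterization by the Iwasawa decomposition. -/
def iwasawaProj (g : Matrix (Fin 3) (Fin 3) ℝ) : Fin 3 → ℝ :=
  let M := g * g.transpose
  let m₁ := M 2 2
  let m₂ := M 1 1 * M 2 2 - M 1 2 * M 2 1
  let δ := Real.log |g.det|
  ![δ - Real.log m₂ / 2 - δ / 3,
    Real.log m₂ / 2 - Real.log m₁ / 2 - δ / 3,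
    Real.log m₁ / 2 - δ / 3]

/-- If `g = c • (u e^X k)` with `u ∈ U`, `X ∈ 𝔞`, `k` orthogonal and `c ≠ 0` a scalar, then the
Iwasawa projection of (the class in `PGL_3(ℝ)` of) `g` is `X`. -/
theorem iwasawaProj_eq (v : UCoord) (X : Fin 3 → ℝ) (hX : X 0 + X 1 + X 2 = 0)
    (k : Matrix (Fin 3) (Fin 3) ℝ) (hk : k * k.transpose = 1) (c : ℝ) (hc : c ≠ 0) :
    iwasawaProj (c • (unip v * Matrix.diagonal (fun i => Real.exp (X i)) * k)) = X := by
  set D : Matrix (Fin 3) (Fin 3) ℝ := Matrix.diagonal (fun i => Real.exp (X i)) with hD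
  set g := c • (unip v * D * k) with hg
  have hM : g * g.transpose = (c ^ 2) • (unip v * D * D * (unip v).transpose) := by
    have h : (unip v * D * k) * (unip v * D * k).transpose
        = unip v * D * D * (unip v).transpose := by
      rw [Matrix.transpose_mul, Matrix.transpose_mul, hD, Matrix.diagonal_transpose, ← hD]
      calc unip v * D * k * (k.transpose * (D * (unip v).transpose))
          = unip v * D * (k * k.transpose) * (D * (unip v).transpose) := by
            simp only [Matrix.mul_assoc]
        _ = _ := by rw [hk]; simp only [Matrix.mul_assoc, Matrix.mul_one]
    rw [hg, Matrix.transpose_smul, Matrix.smul_mul, Matrix.mul_smul, h, smul_smul, sq]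
  have hu : (unip v).det = 1 := by simp [unip, Matrix.det_fin_three]
  have hDd : D.det = 1 := by
    rw [hD, Matrix.det_diagonal, Fin.prod_univ_three, ← Real.exp_add, ← Real.exp_add, hX,
      Real.exp_zero]
  have hkd : |k.det| = 1 := by
    have h := congrArg Matrix.det hk
    rw [Matrix.det_mul, Matrix.det_transpose, Matrix.det_one, ← abs_mul_abs_self] at h
    nlinarith [abs_nonneg k.det]
  have hdet : Real.log |g.det| = 3 * Real.log |c| := by
    rw [hg, Matrix.det_smul, Matrix.det_mul, Matrix.det_mul, hu, hDd, abs_mul, abs_mul, hkd,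
      abs_pow]
    simp
  have e22 : (g * g.transpose) 2 2 = (c * Real.exp (X 2)) ^ 2 := by
    rw [hM, hD]
    simp only [Matrix.smul_apply, Matrix.mul_apply, Fin.sum_univ_three, Matrix.transpose_apply,
      Matrix.diagonal_apply]
    simp [unip]
    ring
  have em : (g * g.transpose) 1 1 * (g * g.transpose) 2 2
      - (g * g.transpose) 1 2 * (g * g.transpose) 2 1
      = (c * Real.exp (X 1)) ^ 2 * (c * Real.exp (X 2)) ^ 2 := by
    rw [hM, hD]
    simp only [Matrix.smul_apply, Matrix.mul_apply, Fin.sum_univ_three, Matrix.transpose_apply,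
      Matrix.diagonal_apply]
    simp [unip]
    ring
  have hlog : ∀ i, Real.log ((c * Real.exp (X i)) ^ 2) = 2 * (Real.log |c| + X i) := by
    intro i
    rw [Real.log_pow, Real.log_mul hc (Real.exp_ne_zero _), Real.log_exp, Real.log_abs]
    norm_num
  have hne : ∀ i, (c * Real.exp (X i)) ^ 2 ≠ 0 := fun i =>
    pow_ne_zero _ (mul_ne_zero hc (Real.exp_ne_zero _))
  have hlm : Real.log ((c * Real.exp (X 1)) ^ 2 * (c * Real.exp (X 2)) ^ 2)
      = 2 * (Real.log |c| + X 1) + 2 * (Real.log |c| + X 2) := by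
    rw [Real.log_mul (hne 1) (hne 2), hlog, hlog]
  funext i
  simp only [iwasawaProj]
  rw [em, e22, hdet, hlm, hlog]
  fin_cases i <;> simp <;> linarith

/-- The self-dual parameter `H = diag(1, 0, -1)` in `𝔞`. -/
def selfDualH : Fin 3 → ℝ := ![1, 0, -1]

/-- The linear functional `ℓ₁` on `U / [U, U]`. -/
def ell (v : UCoord) : ℝ := v.1 + v.2.1

/-- Coordinates `(n, y)` on `S = G / K` through the Iwasawa decomposition, the point being the
class of `unip n * diagA y`; the second component lies in `torus`. -/
abbrev SCoord := UCoord × ACoord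

/-- The Whittaker phase function `F(u, x) = B(H, H(w u g)) - ℓ₁(u)` for `x = g K`, where
`B(X, Y) = tr(X Y)`. -/
def phase (u : UCoord) (x : SCoord) : ℝ :=
  Matrix.trace (Matrix.diagonal selfDualH *
    Matrix.diagonal (iwasawaProj (longWeyl * unip u * (unip x.1 * diagA x.2)))) - ell u

/-- The fibre critical set of the phase function: pairs `(u, x)` such that `u` is a critical point
of `F(·, x)`. -/
def fibreCritical : Set (UCoord × SCoord) :=
  {q | q.2.2 ∈ torus ∧ HasFDerivAt (fun u => phase u q.2) (0 : UCoord →L[ℝ] ℝ) q.1}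

/-- The Lagrangian `Λ ⊆ T^*S`, the image of the fibre critical set under
`(u, x) ↦ (x, d_x F(u, x))`. A point of `T^*S` is a point of `S` with a covector. -/
def lagrangian : Set (SCoord × (SCoord →L[ℝ] ℝ)) :=
  {q | ∃ u : UCoord, (u, q.1) ∈ fibreCritical ∧ HasFDerivAt (fun x => phase u x) q.2 q.1}

/-- `T^*A` in root coordinates. -/
abbrev CotA := ACoord × (ACoord →L[ℝ] ℝ)

/-- The projection `T^*S → T^*A` coming from `S = U × A`. On the level set over `ℓ₁` of the moment
map of the left `U`-action, which contains `Λ`, its fibres are exactly the `U`-orbits, so that it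
identifies the symplectic reduction of `T^*S` over `ℓ₁` with `T^*A`. -/
def reduce (q : SCoord × (SCoord →L[ℝ] ℝ)) : CotA :=
  (q.1.2, q.2.comp (ContinuousLinearMap.inr ℝ UCoord ACoord))

/-- The reduced Lagrangian `Λ^red = U \ Λ`, inside `T^*A`. The Lagrangian mapping is the
restriction to it of the projection `Prod.fst : T^*A → A`. -/
def lagrangianRed : Set CotA := reduce '' lagrangian

/-- The fibre over `y` of the Lagrangian mapping `Λ^red → A`. -/
def fibre (y : ACoord) : Set CotA := {p | p ∈ lagrangianRed ∧ p.1 = y}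

/-- The tangent space at `p` of a submanifold `L`: the velocities of smooth curves in `L`. -/
def tangentVectors {E : Type*} [NormedAddCommGroup E] [NormedSpace ℝ E] (L : Set E) (p : E) :
    Set E :=
  {τ | ∃ γ : ℝ → E, (∀ᶠ t in 𝓝 (0 : ℝ), ContDiffAt ℝ ∞ γ t ∧ γ t ∈ L) ∧ γ 0 = p ∧
    HasDerivAt γ τ 0}

/-- `p` is singular for the mapping `Λ^red → A`: the differential from the tangent space of
`Λ^red` at `p` to the (two-dimensional) tangent space of `A` is not of full rank. -/
def IsSingular (p : CotA) : Prop :=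
  p ∈ lagrangianRed ∧ Prod.fst '' tangentVectors lagrangianRed p ≠ Set.univ

/-- `p` is a nondegenerate (regular) point of the mapping `Λ^red → A`. -/
def IsNondegenerate (p : CotA) : Prop :=
  p ∈ lagrangianRed ∧ Prod.fst '' tangentVectors lagrangianRed p = Set.univ

/-- Near `p ∈ Λ^red`, the set `Λ^red` is an embedded smooth surface, and the germ at `p` of
`Λ^red → A` agrees with the germ at `0` of `f : ℝ² → ℝ²` up to smooth changes of coordinates in the
source and in the target. Here `φ` is a parametrization of a neighbourhood of `p` in `Λ^red` (a
smooth immersion carrying the neighbourhoods of `0` to those of `p` in `Λ^red`), and `ψ` is a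
local diffeomorphism of `A` at `p.1`. -/
def HasNormalForm (p : CotA) (f : ℝ × ℝ → ℝ × ℝ) : Prop :=
  p ∈ lagrangianRed ∧
  ∃ (φ : ℝ × ℝ → CotA) (φ' : ℝ × ℝ →L[ℝ] CotA)
    (ψ : ACoord → ℝ × ℝ) (ψ' : ACoord ≃L[ℝ] ℝ × ℝ),
    φ 0 = p ∧ (∀ᶠ z in 𝓝 (0 : ℝ × ℝ), ContDiffAt ℝ ∞ φ z) ∧
    HasFDerivAt φ φ' 0 ∧ Function.Injective φ' ∧
    Filter.map φ (𝓝 0) = 𝓝[lagrangianRed] p ∧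
    (∀ᶠ y in 𝓝 p.1, ContDiffAt ℝ ∞ ψ y) ∧
    HasFDerivAt ψ (ψ' : ACoord →L[ℝ] ℝ × ℝ) p.1 ∧
    ∀ᶠ z in 𝓝 (0 : ℝ × ℝ), ψ (φ z).1 = f z

/-- Fold (type `A₂`) points of `Λ^red → A`. -/
def IsFoldPoint (p : CotA) : Prop := HasNormalForm p (fun z => (z.1 ^ 2, z.2))

/-- Cusp (type `A₃`, Whitney pleat) points of `Λ^red → A`. -/
def IsCuspPoint (p : CotA) : Prop := HasNormalForm p (fun z => (z.1 ^ 3 + z.1 * z.2, z.2))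

/-- The caustic locus: the image of the singular points. -/
def caustic : Set ACoord := Prod.fst '' {p : CotA | IsSingular p}

/-- The light zone: the image of `Λ^red` outside the caustic. -/
def light : Set ACoord := Prod.fst '' lagrangianRed \ caustic

/-- The shadow zone: the complement in `A` of the image of `Λ^red`. -/
def shadow : Set ACoord := torus \ Prod.fst '' lagrangianRed

/-- The polynomial `27 y₁⁴ y₂⁴ - 18 y₁² y₂² + 4 y₂² + 4 y₁²`. -/
def causticPoly (y : ACoord) : ℝ :=
  27 * y.1 ^ 4 * y.2 ^ 4 - 18 * y.1 ^ 2 * y.2 ^ 2 + 4 * y.2 ^ 2 + 4 * y.1 ^ 2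

def L₁ : Set ACoord := {y | y ∈ torus ∧ causticPoly y < 1}

def L₂ : Set ACoord := {y | y ∈ torus ∧ 1 < causticPoly y ∧ y.1 ^ 2 + y.2 ^ 2 < 1}

def aCusp : ACoord := (1 / √3, 1 / √3)

def C₁ : Set ACoord := {y | y ∈ torus ∧ y.1 ^ 2 + y.2 ^ 2 = 1}

def C₂ : Set ACoord := {y | y ∈ torus ∧ y ≠ aCusp ∧ causticPoly y = 1}

end

end PGL3Whittaker

open PGL3Whittaker

namespace PGL3Whittaker

noncomputable section

/-! Up to the term `ell n`, the phase depends on `u` and `n` only through their product, so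
reduction by U leaves the critical points v = (p, q, r) of `core` in its first argument, each with
its covector in the y-directions. Write A = y₁², B = y₂² and D₁, D₂ for `minorOne`, `minorTwo`. The
critical equations force r/D₁ = (pq - r)/D₂ = 1/2 (`critical_algebra`). With x = -(1 + p) = y₁
∂F/∂y₁ and t = D₁/D₂ they become A = (1 - x²)/(1 + t), B = t(1 - t²x²)/(1 + t) and y₂ ∂F/∂y₂ = tx.
Hence (x, t) is a global chart of Λ^red (`lagrangianRed_eq_image_chart`), and the theorem is about
an explicit map of surfaces.

Two identities govern this map. First, A + B = 1 - x²(1 - t + t²) with 1 - t + t² > 0: the image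
lies in the closed unit disc, and the line x = 0 folds onto the boundary circle. Second, eliminating
x shows that t is a root of A t³ - t² + t - B, whose discriminant is 1 - P. Inside the open disc
every real root t is positive and satisfies A(1 + t) < 1, so it carries exactly the two points x =
±√(1 - A(1 + t)). The fibre is therefore twice as large as the set of real roots, which has three
elements for P < 1 and one for P > 1. The curve P = 1 lies in the open disc because P - 1 = 3(3AB -
1)² + 4(A + B - 1).

Where x ≠ 0, the pair (A, t) is a local coordinate system and the map is (A, t) ↦ (A, A t³ - t² +
t). It is singular exactly at multiple roots: a fold at a double root, a pleat at the triple root t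
= 1, A = B = 1/3. The normal forms come from completing the square or the cube
(`hasNormalForm_of_cubic`). -/

/-! ### Reduction of the phase function by U -/

/-- Coordinates of `unip u * unip n`. -/
def mulU (u n : UCoord) : UCoord :=
  (u.1 + n.1, u.2.1 + n.2.1, u.2.2 + u.1 * n.2.1 + n.2.2)

/-- The upper left entry of `(unip v * diagA y) (unip v * diagA y)ᵀ`. -/
def minorOne (v : UCoord) (y : ACoord) : ℝ :=
  y.1 ^ 2 * y.2 ^ 2 + v.1 ^ 2 * y.2 ^ 2 + v.2.2 ^ 2

/-- The upper left `2 × 2` minor of `(unip v * diagA y) (unip v * diagA y)ᵀ`, up to `y₂²`. -/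
def minorTwo (v : UCoord) (y : ACoord) : ℝ :=
  y.1 ^ 2 * y.2 ^ 2 + y.1 ^ 2 * v.2.1 ^ 2 + (v.1 * v.2.1 - v.2.2) ^ 2

/-- The phase function at the base point of `U`. -/
def core (v : UCoord) (y : ACoord) : ℝ :=
  Real.log (y.1 * y.2 ^ 2) - Real.log (y.2 ^ 2 * minorTwo v y) / 2
    - Real.log (minorOne v y) / 2 - (v.1 + v.2.1)

/-- The directional derivative of `core` at `(v, y)` along `(v', y')`. -/
def coreDeriv (v : UCoord) (y : ACoord) (v' : UCoord) (y' : ACoord) : ℝ :=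
  y'.1 / y.1 + y'.2 / y.2
    - (y.1 * y'.1 * y.2 ^ 2 + y.1 ^ 2 * y.2 * y'.2 + y.1 * y'.1 * v.2.1 ^ 2
        + y.1 ^ 2 * v.2.1 * v'.2.1
        + (v.1 * v.2.1 - v.2.2) * (v'.1 * v.2.1 + v.1 * v'.2.1 - v'.2.2)) / minorTwo v y
    - (y.1 * y'.1 * y.2 ^ 2 + y.1 ^ 2 * y.2 * y'.2 + v.1 * v'.1 * y.2 ^ 2
        + v.1 ^ 2 * y.2 * y'.2 + v.2.2 * v'.2.2) / minorOne v y
    - (v'.1 + v'.2.1)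

/-- The Iwasawa projection sees only the product of the two unipotents, and `ell` is additive on U,
so replacing `ell u` by its value on the product costs `ell n`. -/
theorem phase_eq_core (u n : UCoord) (y : ACoord) :
    phase u (n, y) = core (mulU u n) y + ell n := by
  set g := longWeyl * unip u * (unip n * diagA y) with hg
  have hg' : g = !![0, 0, 1; 0, y.2, u.2.1 + n.2.1;
      y.1 * y.2, (u.1 + n.1) * y.2, u.2.2 + u.1 * n.2.1 + n.2.2] := by
    have hd : diagA y = !![y.1 * y.2, 0, 0; 0, y.2, 0; 0, 0, 1] := by
      ext i j
      fin_cases i <;> fin_cases j <;> rfl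
    rw [hg, hd]
    ext i j
    fin_cases i <;> fin_cases j <;>
      simp [longWeyl, unip, Matrix.mul_apply, Fin.sum_univ_three] <;> ring
  have hdet : g.det = -(y.1 * y.2 ^ 2) := by
    rw [hg', Matrix.det_fin_three]
    simp
    ring
  have h22 : (g * g.transpose) 2 2 = minorOne (mulU u n) y := by
    rw [hg']
    simp [Matrix.mul_apply, Fin.sum_univ_three, minorOne, mulU]
    ring
  have hm : (g * g.transpose) 1 1 * (g * g.transpose) 2 2
      - (g * g.transpose) 1 2 * (g * g.transpose) 2 1 = y.2 ^ 2 * minorTwo (mulU u n) y := by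
    rw [hg']
    simp [Matrix.mul_apply, Fin.sum_univ_three, minorTwo, mulU]
    ring
  have ht : ∀ X : Fin 3 → ℝ,
      Matrix.trace (Matrix.diagonal selfDualH * Matrix.diagonal X) = X 0 - X 2 := by
    intro X
    simp [Matrix.trace, Fin.sum_univ_three, selfDualH]
    ring
  simp only [phase]
  rw [← hg, ht]
  simp only [iwasawaProj]
  rw [hm, h22, hdet, Real.log_abs, Real.log_neg_eq_log]
  simp [core, ell, mulU]
  ring

theorem minorOne_pos (v : UCoord) {y : ACoord} (hy : y ∈ torus) : 0 < minorOne v y := by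
  obtain ⟨h1, h2⟩ := hy
  unfold minorOne
  positivity

theorem minorTwo_pos (v : UCoord) {y : ACoord} (hy : y ∈ torus) : 0 < minorTwo v y := by
  obtain ⟨h1, h2⟩ := hy
  unfold minorTwo
  positivity

theorem core_differentiableAt (v : UCoord) {y : ACoord} (hy : y ∈ torus) :
    DifferentiableAt ℝ (fun w : UCoord × ACoord => core w.1 w.2) (v, y) := by
  have h1 := (minorOne_pos v hy).ne'
  have h2 := (minorTwo_pos v hy).ne'
  obtain ⟨ha, hb⟩ := hy
  have h3 : y.1 * y.2 ^ 2 ≠ 0 := by positivity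
  have h4 : y.2 ^ 2 * minorTwo v y ≠ 0 := mul_ne_zero (by positivity) h2
  unfold core
  unfold minorOne at *
  unfold minorTwo at *
  have k0 : DifferentiableAt ℝ (fun w : UCoord × ACoord => w.2.1 * w.2.2 ^ 2) (v, y) := by
    fun_prop
  have k1 : DifferentiableAt ℝ (fun w : UCoord × ACoord => w.2.1 ^ 2 * w.2.2 ^ 2
      + w.1.1 ^ 2 * w.2.2 ^ 2 + w.1.2.2 ^ 2) (v, y) := by fun_prop
  have k2 : DifferentiableAt ℝ (fun w : UCoord × ACoord => w.2.2 ^ 2 * (w.2.1 ^ 2 * w.2.2 ^ 2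
      + w.2.1 ^ 2 * w.1.2.1 ^ 2 + (w.1.1 * w.1.2.1 - w.1.2.2) ^ 2)) (v, y) := by fun_prop
  have j0 := k0.log h3
  have j1 := k1.log h1
  have j2 := k2.log h4
  simp only [div_eq_mul_inv]
  exact ((j0.sub (j2.mul_const _)).sub (j1.mul_const _)).sub (by fun_prop)

/-- Differentials are compared by their values on lines; together with `core_differentiableAt` this
identifies them without writing out a Fréchet derivative. -/
theorem core_hasDerivAt (v v' : UCoord) {y : ACoord} (y' : ACoord) (hy : y ∈ torus) :
    HasDerivAt (fun s : ℝ => core (v + s • v') (y + s • y')) (coreDeriv v y v' y') 0 := by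
  have h1 := (minorOne_pos v hy).ne'
  have h2 := (minorTwo_pos v hy).ne'
  obtain ⟨ha, hb⟩ := hy
  have hl : ∀ a b : ℝ, HasDerivAt (fun s : ℝ => a + s * b) b 0 := by
    intro a b
    simpa using ((hasDerivAt_id (0 : ℝ)).mul_const b).const_add a
  have e1 := hl y.1 y'.1
  have e2 := hl y.2 y'.2
  have ep := hl v.1 v'.1
  have eq := hl v.2.1 v'.2.1
  have er := hl v.2.2 v'.2.2
  have d1 := ((e1.pow 2).mul (e2.pow 2)).add ((ep.pow 2).mul (e2.pow 2)) |>.add (er.pow 2)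
  have d2 := ((e1.pow 2).mul (e2.pow 2)).add ((e1.pow 2).mul (eq.pow 2))
    |>.add (((ep.mul eq).sub er).pow 2)
  have k0 := (e1.mul (e2.pow 2)).log (by simp; exact ⟨ha.ne', hb.ne'⟩)
  have k1 := d1.log (by simpa [minorOne] using h1)
  have k2 := ((e2.pow 2).mul d2).log (by
    simpa [minorTwo] using ⟨hb.ne', h2⟩)
  have k := ((k0.sub (k2.div_const 2)).sub (k1.div_const 2)).sub (ep.add eq)
  refine (k.congr_deriv ?_).congr_of_eventuallyEq (Filter.Eventually.of_forall fun s => ?_)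
  · simp only [Pi.add_apply, Pi.mul_apply, Pi.pow_apply, Pi.sub_apply, zero_mul, add_zero]
    have e1' : y.1 ^ 2 * y.2 ^ 2 + v.1 ^ 2 * y.2 ^ 2 + v.2.2 ^ 2 = minorOne v y := rfl
    have e2' : y.1 ^ 2 * y.2 ^ 2 + y.1 ^ 2 * v.2.1 ^ 2 + (v.1 * v.2.1 - v.2.2) ^ 2
      = minorTwo v y := rfl
    rw [e1', e2', coreDeriv]
    have := ha.ne'
    have := hb.ne'
    field_simp
    push_cast
    ring
  · simp [core, minorOne, minorTwo]

theorem mulU_add_smul (u e n : UCoord) (s : ℝ) :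
    mulU (u + s • e) n = mulU u n + s • (e.1, e.2.1, e.2.2 + e.1 * n.2.1) := by
  ext <;> simp [mulU] <;> ring

theorem mulU_zero (u : UCoord) : mulU u 0 = u := by
  ext <;> simp [mulU]

theorem HasFDerivAt.hasDerivAt_line {E : Type*} [NormedAddCommGroup E] [NormedSpace ℝ E]
    {f : E → ℝ} {L : E →L[ℝ] ℝ} {x : E} (h : HasFDerivAt f L x) (e : E) :
    HasDerivAt (fun s : ℝ => f (x + s • e)) (L e) 0 := by
  have hl : HasDerivAt (fun s : ℝ => x + s • e) e 0 := by
    simpa using ((hasDerivAt_id (0 : ℝ)).smul_const e).const_add x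
  have h' : HasFDerivAt f L (x + (0 : ℝ) • e) := by simpa using h
  exact h'.comp_hasDerivAt 0 hl

theorem lagrangianRed_eq : lagrangianRed = {c : CotA | c.1 ∈ torus ∧ ∃ v : UCoord,
    (∀ v', coreDeriv v c.1 v' 0 = 0) ∧ ∀ y', c.2 y' = coreDeriv v c.1 0 y'} := by
  ext ⟨y, ζ⟩
  constructor
  · rintro ⟨⟨⟨n, y₀⟩, ξ⟩, ⟨u, ⟨hy, hu⟩, hx⟩, he⟩
    simp only [reduce, Prod.mk.injEq] at he
    obtain ⟨rfl, rfl⟩ := he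
    refine ⟨hy, mulU u n, fun v' => ?_, fun y' => ?_⟩
    -- Right translation by n shears the last coordinate; the correction - v'₁ n₂₃ makes the product
    -- move in direction `v'`.
    · have h1 := HasFDerivAt.hasDerivAt_line hu (v'.1, v'.2.1, v'.2.2 - v'.1 * n.2.1)
      have h2 := (core_hasDerivAt (mulU u n) v' 0 hy).add_const (ell n)
      refine h2.unique (h1.congr_of_eventuallyEq (Filter.Eventually.of_forall fun s => ?_))
      beta_reduce
      rw [phase_eq_core, mulU_add_smul, smul_zero, add_zero]
      simp
    · have h1 := HasFDerivAt.hasDerivAt_line hx (0, y')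
      have h2 := (core_hasDerivAt (mulU u n) 0 y' hy).add_const (ell n)
      refine (h1.congr_of_eventuallyEq (Filter.Eventually.of_forall fun s => ?_)).unique h2
      simp [phase_eq_core]
  · rintro ⟨hy, v, hv, hζ⟩
    have hd := core_differentiableAt v hy
    -- Every U-orbit in Λ has a representative over n = 0, where `mulU` is trivial and the critical
    -- point of `core` itself serves as u.
    have hu : HasFDerivAt (fun u => phase u (0, y)) (0 : UCoord →L[ℝ] ℝ) v := by
      have h1 : DifferentiableAt ℝ (fun u => phase u (0, y)) v := by
        have : (fun u => phase u (0, y)) = fun u => core u y + ell 0 := by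
          funext u
          rw [phase_eq_core, mulU_zero]
        rw [this]
        exact (DifferentiableAt.comp (f := fun u : UCoord => (u, y)) v hd
          (by fun_prop)).add_const _
      convert h1.hasFDerivAt using 1
      refine ContinuousLinearMap.ext fun v' => ?_
      refine (hv v').symm.trans ?_
      refine ((core_hasDerivAt v v' 0 hy).add_const (ell 0)).unique
        ((HasFDerivAt.hasDerivAt_line h1.hasFDerivAt v').congr_of_eventuallyEq
        (Filter.Eventually.of_forall fun s => ?_))
      simp [phase_eq_core, mulU_zero]
    have hx : DifferentiableAt ℝ (fun x => phase v x) ((0, y) : SCoord) := by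
      have : (fun x => phase v x) = fun x : SCoord => core (mulU v x.1) x.2 + ell x.1 := by
        funext x
        rw [← phase_eq_core]
      rw [this]
      have hm : DifferentiableAt ℝ (fun x : SCoord => (mulU v x.1, x.2)) (0, y) := by
        unfold mulU
        fun_prop
      refine DifferentiableAt.add ?_ (by unfold ell; fun_prop)
      exact DifferentiableAt.comp (f := fun x : SCoord => (mulU v x.1, x.2))
        (g := fun w : UCoord × ACoord => core w.1 w.2) ((0, y) : SCoord)
        (by simpa [mulU_zero] using hd) hm
    refine ⟨((0, y), fderiv ℝ (fun x => phase v x) (0, y)), ⟨v, ⟨hy, hu⟩, hx.hasFDerivAt⟩, ?_⟩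
    simp only [reduce, Prod.mk.injEq, true_and]
    refine ContinuousLinearMap.ext fun y' => ?_
    refine Eq.trans ?_ (hζ y').symm
    refine (HasFDerivAt.hasDerivAt_line hx.hasFDerivAt (0, y')).unique
      (((core_hasDerivAt v 0 y' hy).add_const (ell 0)).congr_of_eventuallyEq
        (Filter.Eventually.of_forall fun s => ?_))
    simp [phase_eq_core, mulU_zero]

/-! ### The global chart (x, t) of Λ^red -/

/-- The square of `y₁` in the global chart `(x, t)` of `Λ^red`. -/
def chartA (w : ℝ × ℝ) : ℝ := (1 - w.1 ^ 2) / (1 + w.2)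

/-- The square of `y₂` in the global chart `(x, t)` of `Λ^red`. -/
def chartB (w : ℝ × ℝ) : ℝ := w.2 * (1 - (w.2 * w.1) ^ 2) / (1 + w.2)

/-- The domain of the global chart of `Λ^red`. -/
def chartDom : Set (ℝ × ℝ) := {w | 0 < w.2 ∧ w.1 ^ 2 < 1 ∧ (w.2 * w.1) ^ 2 < 1}

/-- The covector on `A` with given partial derivatives. -/
def covec (c : ℝ × ℝ) : ACoord →L[ℝ] ℝ :=
  c.1 • ContinuousLinearMap.fst ℝ ℝ ℝ + c.2 • ContinuousLinearMap.snd ℝ ℝ ℝ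

/-- The Lagrangian mapping in the global chart. -/
def chartProj (w : ℝ × ℝ) : ACoord := (√(chartA w), √(chartB w))

/-- The global chart of `Λ^red`. The first coordinate is `y₁ ∂F/∂y₁`, the second one is the
quotient of `y₂ ∂F/∂y₂` by `y₁ ∂F/∂y₁`. -/
def chart (w : ℝ × ℝ) : CotA :=
  (chartProj w, covec (w.1 / √(chartA w), w.2 * w.1 / √(chartB w)))

/-- A smooth left inverse of `chart`. -/
def chartInv (c : CotA) : ℝ × ℝ :=
  (c.1.1 * c.2 (1, 0), (1 - (c.1.1 * c.2 (1, 0)) ^ 2) / c.1.1 ^ 2 - 1)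

theorem chartA_pos {w : ℝ × ℝ} (hw : w ∈ chartDom) : 0 < chartA w := by
  obtain ⟨h1, h2, h3⟩ := hw
  exact div_pos (by linarith) (by linarith)

theorem chartB_pos {w : ℝ × ℝ} (hw : w ∈ chartDom) : 0 < chartB w := by
  obtain ⟨h1, h2, h3⟩ := hw
  exact div_pos (mul_pos h1 (by linarith)) (by linarith)

theorem chartProj_mem_torus {w : ℝ × ℝ} (hw : w ∈ chartDom) : chartProj w ∈ torus :=
  ⟨Real.sqrt_pos.2 (chartA_pos hw), Real.sqrt_pos.2 (chartB_pos hw)⟩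

theorem chartProj_eq_iff {w : ℝ × ℝ} (hw : w ∈ chartDom) {y : ACoord} (hy : y ∈ torus) :
    chartProj w = y ↔ chartA w = y.1 ^ 2 ∧ chartB w = y.2 ^ 2 := by
  rw [chartProj, Prod.ext_iff, Real.sqrt_eq_iff_eq_sq (chartA_pos hw).le hy.1.le,
    Real.sqrt_eq_iff_eq_sq (chartB_pos hw).le hy.2.le]

theorem covec_apply (c : ℝ × ℝ) (y : ACoord) : covec c y = c.1 * y.1 + c.2 * y.2 := rfl

theorem eq_covec (ζ : ACoord →L[ℝ] ℝ) : ζ = covec (ζ (1, 0), ζ (0, 1)) := by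
  refine ContinuousLinearMap.ext fun y => ?_
  rw [covec_apply]
  have : y = y.1 • ((1, 0) : ACoord) + y.2 • ((0, 1) : ACoord) := by
    ext <;> simp
  conv_lhs => rw [this, map_add, map_smul, map_smul]
  simp [mul_comm]

theorem chartInv_chart {w : ℝ × ℝ} (hw : w ∈ chartDom) : chartInv (chart w) = w := by
  have hA := chartA_pos hw
  have hs := (Real.sqrt_pos.2 hA).ne'
  have h1 : 1 - w.1 ^ 2 ≠ 0 := by have := hw.2.1; linarith
  have h2 : 1 + w.2 ≠ 0 := by have := hw.1; linarith
  have hx : √(chartA w) * (w.1 / √(chartA w)) = w.1 := by field_simp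
  ext
  · simp [chartInv, chart, chartProj, covec_apply, hx]
  · simp only [chartInv, chart, chartProj, covec_apply, mul_one, mul_zero, add_zero, hx]
    rw [Real.sq_sqrt hA.le, chartA]
    field_simp
    ring

theorem chart_injOn : Set.InjOn chart chartDom := fun a ha b hb h => by
  rw [← chartInv_chart ha, ← chartInv_chart hb, h]

/-- The hypotheses are the critical equations in the p, q and r directions. The common value k of
the two ratios in `h₃` turns out to be 1/2, after which all the relations are linear consequences.
-/
theorem critical_algebra {A B p q r D₁ D₂ : ℝ} (hD₁ : 0 < D₁) (hD₂ : 0 < D₂)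
    (e₁ : D₁ = A * B + p ^ 2 * B + r ^ 2) (e₂ : D₂ = A * B + A * q ^ 2 + (p * q - r) ^ 2)
    (h₁ : (p * q - r) * q / D₂ + p * B / D₁ = -1)
    (h₂ : (A * q + (p * q - r) * p) / D₂ = -1) (h₃ : (p * q - r) / D₂ = r / D₁) :
    (A * B + A * q ^ 2) / D₂ + A * B / D₁ = 2 + p ∧
    A * B / D₂ + (A * B + p ^ 2 * B) / D₁ = 2 + q ∧
    D₁ * (1 + p) = D₂ * (1 + q) ∧ 2 * (p * q) = D₁ + D₂ ∧
    2 * (A * q) = -D₂ * (2 + p) ∧ 2 * (p * B) = -D₁ * (2 + q) := by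
  obtain ⟨k, hk⟩ : ∃ k, k = r / D₁ := ⟨_, rfl⟩
  have hr : r = k * D₁ := by rw [hk]; field_simp
  have hs : p * q - r = k * D₂ := by rw [hk, ← h₃]; field_simp
  have h1 : p * B + k * q * D₁ = -D₁ := by
    rw [hs] at h₁
    field_simp at h₁
    linarith
  have h2 : A * q + k * p * D₂ = -D₂ := by
    rw [hs] at h₂
    field_simp at h₂
    linarith
  have hpq : p * q = k * (D₁ + D₂) := by linarith
  rw [hs] at e₂
  rw [hr] at e₁
  have f1 : A * B = D₁ * (1 + p + k ^ 2 * D₂) := by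
    linear_combination (-1) * e₁ - p * h1 + k * D₁ * hpq
  have f2 : A * B = D₂ * (1 + q + k ^ 2 * D₁) := by
    linear_combination (-1) * e₂ - q * h2 + k * D₂ * hpq
  have f3 : D₁ * (1 + p) = D₂ * (1 + q) := by linear_combination f2 - f1
  have f4 : (p * B) * (A * q) = D₁ * D₂ * ((1 + k * q) * (1 + k * p)) := by
    rw [show p * B = -(D₁ * (1 + k * q)) by linarith, show A * q = -(D₂ * (1 + k * p)) by linarith]
    ring
  -- The product AB·pq is computed twice: by `f4`, and from pq = k(D₁ + D₂) with D₂·AB and D₁·AB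
  -- taken from `f1` and `f2`. The terms in k³ cancel, and so do those in p and q.
  have f5 : D₁ * D₂ * (1 - 2 * k) = 0 := by
    linear_combination (-1) * f4 + A * B * hpq - D₁ * D₂ * k ^ 2 * hpq + k * D₂ * f1 + k * D₁ * f2
  have hk2 : k = 1 / 2 := by
    have := (mul_eq_zero.1 f5).resolve_left (by positivity)
    linarith
  subst hk2
  refine ⟨?_, ?_, f3, by linarith, by linarith, by linarith⟩
  · rw [div_add_div _ _ hD₂.ne' hD₁.ne', div_eq_iff (by positivity)]
    linear_combination D₂ * f1 - D₁ * e₂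
  · rw [div_add_div _ _ hD₂.ne' hD₁.ne', div_eq_iff (by positivity)]
    linear_combination D₁ * f2 - D₂ * e₁

theorem lagrangianRed_eq_image_chart : lagrangianRed = chart '' chartDom := by
  rw [lagrangianRed_eq]
  ext ⟨y, ζ⟩
  constructor
  · rintro ⟨hy, ⟨p, q, r⟩, hv, hζ⟩
    have hD₁ := minorOne_pos (p, q, r) hy
    have hD₂ := minorTwo_pos (p, q, r) hy
    have c₁ := hv (1, 0, 0)
    have c₂ := hv (0, 1, 0)
    have c₃ := hv (0, 0, 1)
    have z₁ := hζ (1, 0)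
    have z₂ := hζ (0, 1)
    obtain ⟨hy1, hy2⟩ := hy
    simp only at hy1 hy2
    simp only [coreDeriv] at c₁ c₂ c₃ z₁ z₂
    have e₁ : minorOne (p, q, r) y = y.1 ^ 2 * y.2 ^ 2 + p ^ 2 * y.2 ^ 2 + r ^ 2 := rfl
    have e₂ : minorTwo (p, q, r) y
      = y.1 ^ 2 * y.2 ^ 2 + y.1 ^ 2 * q ^ 2 + (p * q - r) ^ 2 := rfl
    generalize minorOne (p, q, r) y = D₁ at *
    generalize minorTwo (p, q, r) y = D₂ at *
    simp at c₁ c₂ c₃ z₁ z₂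
    obtain ⟨g₁, g₂, g₃, g₄, g₅, g₆⟩ := critical_algebra hD₁ hD₂ e₁ e₂ (by linarith)
      (by linarith) (by rw [← neg_sub r, neg_div]; linarith)
    have x₁ : y.1 * ζ (1, 0) = -(1 + p) := by
      rw [z₁]
      field_simp at g₁ ⊢
      linarith
    have x₂ : y.2 * ζ (0, 1) = -(1 + q) := by
      rw [z₂]
      field_simp at g₂ ⊢
      linarith
    have hA : 0 < y.1 ^ 2 := by positivity
    have hB : 0 < y.2 ^ 2 := by positivity
    have hpq : 0 < p * q := by linarith
    have hp : p ≠ 0 := by rintro rfl; simp at hpq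
    have hq : q ≠ 0 := by rintro rfl; simp at hpq
    -- Since D₁ + D₂ = 2pq and 2Aq = -D₂(2 + p), both sides times q agree; 1 - (1 + p)² is -p(2 +
    -- p).
    have hAt : y.1 ^ 2 * (D₁ + D₂) = D₂ * (1 - (1 + p) ^ 2) := by
      apply mul_left_cancel₀ hq
      linear_combination (-y.1 ^ 2 * q) * g₄ + p * q * g₅
    have hBt : y.2 ^ 2 * (D₁ + D₂) = D₁ * (1 - (1 + q) ^ 2) := by
      apply mul_left_cancel₀ hp
      linear_combination (-y.2 ^ 2 * p) * g₄ + p * q * g₆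
    have hx1 : (1 + p) ^ 2 < 1 := by
      have : 0 < D₂ * (1 - (1 + p) ^ 2) := by rw [← hAt]; positivity
      have := (mul_pos_iff_of_pos_left hD₂).1 this
      linarith
    have hx2 : (1 + q) ^ 2 < 1 := by
      have : 0 < D₁ * (1 - (1 + q) ^ 2) := by rw [← hBt]; positivity
      have := (mul_pos_iff_of_pos_left hD₁).1 this
      linarith
    have ht : D₁ / D₂ * -(1 + p) = -(1 + q) := by
      field_simp
      linarith
    have hw : (-(1 + p), D₁ / D₂) ∈ chartDom := by
      refine ⟨div_pos hD₁ hD₂, by simpa only [neg_sq] using hx1, ?_⟩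
      simp only [ht]
      simpa only [neg_sq] using hx2
    have hproj : chartProj (-(1 + p), D₁ / D₂) = y := by
      refine (chartProj_eq_iff hw ⟨hy1, hy2⟩).2 ⟨?_, ?_⟩
      · simp only [chartA]
        rw [div_eq_iff (by positivity)]
        field_simp
        linarith
      · simp only [chartB, ht]
        rw [div_eq_iff (by positivity)]
        field_simp
        linarith
    refine ⟨_, hw, ?_⟩
    have hs := Prod.ext_iff.1 hproj
    simp only [chartProj] at hs
    rw [chart, hproj, eq_covec ζ, hs.1, hs.2, ht, ← x₁, ← x₂]
    simp only [mul_div_cancel_left₀ _ hy1.ne', mul_div_cancel_left₀ _ hy2.ne']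
  · rintro ⟨⟨x, t⟩, hw, h⟩
    obtain ⟨rfl, rfl⟩ := Prod.ext_iff.1 h
    refine ⟨chartProj_mem_torus hw, ?_⟩
    have hA := Real.sq_sqrt (chartA_pos hw).le
    have hB := Real.sq_sqrt (chartB_pos hw).le
    obtain ⟨hy1, hy2⟩ := chartProj_mem_torus hw
    simp only [chart]
    simp only [chartProj] at *
    generalize √(chartA (x, t)) = y₁ at *
    generalize √(chartB (x, t)) = y₂ at *
    obtain ⟨ht, hx, hz⟩ := hw
    simp only [chartA, chartB] at *
    have hx' : 0 < 1 + x := by nlinarith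
    have hz' : 0 < 1 + t * x := by nlinarith
    -- This is 2pq = D₁ + D₂ solved for D₂, with D₁ = t D₂; the coordinate r = D₁/2 is then t D₂/2.
    obtain ⟨D₂, hD₂⟩ : ∃ D₂, D₂ = 2 * (1 + x) * (1 + t * x) / (1 + t) := ⟨_, rfl⟩
    have hD₂pos : 0 < D₂ := by rw [hD₂]; positivity
    have e₁ : minorOne (-(1 + x), -(1 + t * x), t * D₂ / 2) (y₁, y₂) = t * D₂ := by
      simp only [minorOne, neg_sq]
      rw [hA, hB, hD₂]
      field_simp
      ring
    have e₂ : minorTwo (-(1 + x), -(1 + t * x), t * D₂ / 2) (y₁, y₂) = D₂ := by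
      simp only [minorTwo, neg_sq]
      rw [hA, hB, hD₂]
      field_simp
      ring
    refine ⟨(-(1 + x), -(1 + t * x), t * D₂ / 2), ?_, ?_⟩
    · rintro ⟨a, b, c⟩
      simp only [coreDeriv, e₁, e₂]
      simp only [Prod.fst_zero, Prod.snd_zero, mul_zero, zero_mul, zero_div, add_zero, zero_add]
      rw [hA, hB, hD₂]
      have hz₂ : 1 + x * t ≠ 0 := by rw [mul_comm]; exact hz'.ne'
      field_simp
      ring
    · rintro ⟨a, b⟩
      simp only [coreDeriv, e₁, e₂, covec_apply]
      simp only [Prod.fst_zero, Prod.snd_zero, mul_zero, zero_mul, add_zero, sub_zero,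
        neg_sq]
      -- Rescaled directions turn the partial derivatives into y₁∂₁ and y₂∂₂, which involve only y₁²
      -- and y₂².
      obtain ⟨a, rfl⟩ : ∃ a', a = y₁ * a' := ⟨a / y₁, by field_simp⟩
      obtain ⟨b, rfl⟩ : ∃ b', b = y₂ * b' := ⟨b / y₂, by field_simp⟩
      have hz₂ : 1 + x * t ≠ 0 := by rw [mul_comm]; exact hz'.ne'
      have i₁ : 1 - y₁ ^ 2 * (y₂ ^ 2 + (1 + t * x) ^ 2) / D₂ - y₁ ^ 2 * y₂ ^ 2 / (t * D₂) = x := by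
        rw [hA, hB, hD₂]
        field_simp
        ring
      have i₂ : 1 - y₁ ^ 2 * y₂ ^ 2 / D₂ - (y₁ ^ 2 + (1 + x) ^ 2) * y₂ ^ 2 / (t * D₂)
          = t * x := by
        rw [hA, hB, hD₂]
        field_simp
        ring
      have j₁ : x / y₁ * (y₁ * a) = x * a := by field_simp
      have j₂ : t * x / y₂ * (y₂ * b) = t * x * b := by field_simp
      rw [j₁, j₂, mul_div_cancel_left₀ _ hy1.ne', mul_div_cancel_left₀ _ hy2.ne']
      linear_combination (-a) * i₁ - b * i₂

/-! ### Smoothness of the chart, tangent vectors and regular points -/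

theorem isOpen_chartDom : IsOpen chartDom := by
  exact (isOpen_lt continuous_const continuous_snd).inter
    ((isOpen_lt (continuous_fst.pow 2) continuous_const).inter
      (isOpen_lt ((continuous_snd.mul continuous_fst).pow 2) continuous_const))

theorem contDiffAt_chartA {w : ℝ × ℝ} (hw : w ∈ chartDom) : ContDiffAt ℝ ω chartA w := by
  have h : 1 + w.2 ≠ 0 := by have := hw.1; linarith
  unfold chartA
  fun_prop (disch := exact h)

theorem contDiffAt_chartB {w : ℝ × ℝ} (hw : w ∈ chartDom) : ContDiffAt ℝ ω chartB w := by
  have h : 1 + w.2 ≠ 0 := by have := hw.1; linarith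
  unfold chartB
  fun_prop (disch := exact h)

theorem contDiffAt_chart {w : ℝ × ℝ} (hw : w ∈ chartDom) : ContDiffAt ℝ ω chart w := by
  have hA := (contDiffAt_chartA hw).sqrt (chartA_pos hw).ne'
  have hB := (contDiffAt_chartB hw).sqrt (chartB_pos hw).ne'
  have hA' := (Real.sqrt_pos.2 (chartA_pos hw)).ne'
  have hB' := (Real.sqrt_pos.2 (chartB_pos hw)).ne'
  refine ContDiffAt.prodMk (hA.prodMk hB) ?_
  unfold covec
  exact ((contDiffAt_fst.div hA hA').smul contDiffAt_const).add
    (((contDiffAt_snd.mul contDiffAt_fst).div hB hB').smul contDiffAt_const)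

theorem contDiffAt_chartInv {c : CotA} (hc : c.1 ∈ torus) : ContDiffAt ℝ ω chartInv c := by
  have h : c.1.1 ^ 2 ≠ 0 := by have := hc.1; positivity
  have hx : ContDiffAt ℝ ω (fun c : CotA => c.1.1 * c.2 (1, 0)) c :=
    ContDiffAt.mul (by fun_prop) (ContDiffAt.clm_apply contDiffAt_snd contDiffAt_const)
  exact hx.prodMk (((contDiffAt_const.sub (hx.pow 2)).div (by fun_prop) h).sub contDiffAt_const)

theorem chart_chartInv {c : CotA} (hc : c ∈ lagrangianRed) :
    chartInv c ∈ chartDom ∧ chart (chartInv c) = c := by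
  rw [lagrangianRed_eq_image_chart] at hc
  obtain ⟨w, hw, rfl⟩ := hc
  rw [chartInv_chart hw]
  exact ⟨hw, rfl⟩

theorem chart_mem {w : ℝ × ℝ} (hw : w ∈ chartDom) : chart w ∈ lagrangianRed := by
  rw [lagrangianRed_eq_image_chart]
  exact ⟨w, hw, rfl⟩

theorem differentiableAt_chart {w : ℝ × ℝ} (hw : w ∈ chartDom) : DifferentiableAt ℝ chart w :=
  (contDiffAt_chart hw).differentiableAt (by simp)

theorem fderiv_chart_injective {w : ℝ × ℝ} (hw : w ∈ chartDom) :
    Function.Injective (fderiv ℝ chart w) := by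
  have h1 := (differentiableAt_chart hw).hasFDerivAt
  have h2 := ((contDiffAt_chartInv (c := chart w) (chartProj_mem_torus hw)).differentiableAt
    (by simp)).hasFDerivAt
  have h3 : HasFDerivAt (chartInv ∘ chart) (ContinuousLinearMap.id ℝ (ℝ × ℝ)) w :=
    (hasFDerivAt_id w).congr_of_eventuallyEq
      (Filter.eventuallyEq_of_mem (isOpen_chartDom.mem_nhds hw) fun z hz => chartInv_chart hz)
  have h4 := (h2.comp w h1).unique h3
  intro a b hab
  have ha := congrArg (fun L => L a) h4
  have hb := congrArg (fun L => L b) h4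
  simp only [ContinuousLinearMap.comp_apply, ContinuousLinearMap.id_apply] at ha hb
  rw [← ha, ← hb, hab]

/-- The left inverse `chartInv` is continuous on the ambient space near the point, so the chart is a
homeomorphism onto Λ^red with its subspace topology. -/
theorem map_chart_nhds {w : ℝ × ℝ} (hw : w ∈ chartDom) :
    Filter.map chart (𝓝 w) = 𝓝[lagrangianRed] (chart w) := by
  apply le_antisymm
  · refine tendsto_nhdsWithin_iff.2 ⟨(differentiableAt_chart hw).continuousAt, ?_⟩
    filter_upwards [isOpen_chartDom.mem_nhds hw] with z hz using chart_mem hz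
  · intro s hs
    have hc : Filter.Tendsto chartInv (𝓝[lagrangianRed] (chart w)) (𝓝 w) := by
      have := (contDiffAt_chartInv (c := chart w) (chartProj_mem_torus hw)).continuousAt
      rw [ContinuousAt, chartInv_chart hw] at this
      exact this.mono_left nhdsWithin_le_nhds
    filter_upwards [hc hs, self_mem_nhdsWithin] with c h1 h2
    simpa [(chart_chartInv h2).2] using h1

/-- A curve in Λ^red is the chart applied to its image under `chartInv`, so its velocity is in the
range; conversely, images of straight lines realise the whole range. -/
theorem tangentVectors_chart {w : ℝ × ℝ} (hw : w ∈ chartDom) :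
    tangentVectors lagrangianRed (chart w) = Set.range (fderiv ℝ chart w) := by
  have h1 := (differentiableAt_chart hw).hasFDerivAt
  ext τ
  constructor
  · rintro ⟨γ, hγ, h0, hτ⟩
    have h2 := ((contDiffAt_chartInv (c := chart w) (chartProj_mem_torus hw)).differentiableAt
      (by simp)).hasFDerivAt
    rw [← h0] at h2
    have h3 := h2.comp_hasDerivAt 0 hτ
    have h4 : chartInv (γ 0) = w := by rw [h0, chartInv_chart hw]
    rw [← h4] at h1
    have h5 := HasFDerivAt.comp_hasDerivAt (l := chart) (f := chartInv ∘ γ) (0 : ℝ) h1 h3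
    rw [← h4]
    refine ⟨_, h5.unique (hτ.congr_of_eventuallyEq ?_)⟩
    filter_upwards [hγ] with t ht using (chart_chartInv ht.2).2
  · rintro ⟨v, rfl⟩
    have hl : ContDiff ℝ ω (fun t : ℝ => w + t • v) := by fun_prop
    have hz : w + (0 : ℝ) • v = w := by simp
    refine ⟨fun t => chart (w + t • v), ?_, by simp, ?_⟩
    · have : ∀ᶠ t in 𝓝 (0 : ℝ), w + t • v ∈ chartDom :=
        hl.continuous.continuousAt.eventually_mem (by
          rw [hz]
          exact isOpen_chartDom.mem_nhds hw)
      filter_upwards [this] with t ht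
      refine ⟨?_, chart_mem ht⟩
      exact (((contDiffAt_chart ht).comp t hl.contDiffAt)).of_le le_top
    · have h2 : HasDerivAt (fun t : ℝ => w + t • v) v 0 := by
        simpa using ((hasDerivAt_id (0 : ℝ)).smul_const v).const_add w
      rw [← hz] at h1
      have h3 := h1.comp_hasDerivAt 0 h2
      rw [hz] at h3
      exact h3

theorem hasFDerivAt_covec {f : ℝ × ℝ → ℝ} {w c : ℝ × ℝ} (hf : DifferentiableAt ℝ f w)
    (h1 : HasDerivAt (fun x => f (x, w.2)) c.1 w.1)
    (h2 : HasDerivAt (fun t => f (w.1, t)) c.2 w.2) : HasFDerivAt f (covec c) w := by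
  have h := hf.hasFDerivAt
  have e1 := h.comp_hasDerivAt (f := fun x => (x, w.2)) w.1
    ((hasDerivAt_id w.1).prodMk (hasDerivAt_const w.1 w.2))
  have e2 := h.comp_hasDerivAt (f := fun t => (w.1, t)) w.2
    ((hasDerivAt_const w.2 w.1).prodMk (hasDerivAt_id w.2))
  rw [eq_covec (fderiv ℝ f w), e1.unique h1, e2.unique h2] at h
  exact h

theorem hasFDerivAt_chartA {w : ℝ × ℝ} (hw : w ∈ chartDom) :
    HasFDerivAt chartA (covec (-2 * w.1 / (1 + w.2), -(1 - w.1 ^ 2) / (1 + w.2) ^ 2)) w := by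
  have h : 1 + w.2 ≠ 0 := by have := hw.1; linarith
  refine hasFDerivAt_covec ((contDiffAt_chartA hw).differentiableAt (by simp)) ?_ ?_
  · have := (((hasDerivAt_id w.1).pow 2).const_sub 1).div_const (1 + w.2)
    refine this.congr_deriv ?_
    simp
  · have := (hasDerivAt_const w.2 (1 - w.1 ^ 2)).div ((hasDerivAt_id w.2).const_add 1) h
    refine this.congr_deriv ?_
    simp

theorem hasFDerivAt_chartB {w : ℝ × ℝ} (hw : w ∈ chartDom) :
    HasFDerivAt chartB (covec (-2 * w.2 ^ 3 * w.1 / (1 + w.2),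
      (1 - 3 * w.2 ^ 2 * w.1 ^ 2 - 2 * w.2 ^ 3 * w.1 ^ 2) / (1 + w.2) ^ 2)) w := by
  have h : 1 + w.2 ≠ 0 := by have := hw.1; linarith
  refine hasFDerivAt_covec ((contDiffAt_chartB hw).differentiableAt (by simp)) ?_ ?_
  · have := (((((hasDerivAt_id w.1).const_mul w.2).pow 2).const_sub 1).const_mul w.2).div_const
      (1 + w.2)
    refine this.congr_deriv ?_
    simp
    ring
  · have := ((hasDerivAt_id w.2).mul ((((hasDerivAt_id w.2).mul_const w.1).pow 2).const_sub 1)).div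
      ((hasDerivAt_id w.2).const_add 1) h
    refine this.congr_deriv ?_
    simp
    ring

theorem image_tangentVectors_eq_univ_iff {w : ℝ × ℝ} (hw : w ∈ chartDom) :
    Prod.fst '' tangentVectors lagrangianRed (chart w) = Set.univ ↔
      w.1 ≠ 0 ∧ 1 - w.2 + w.2 ^ 2 - 3 * w.2 ^ 2 * w.1 ^ 2 ≠ 0 := by
  have h1 := (differentiableAt_chart hw).hasFDerivAt.fst
  have h2 := ((hasFDerivAt_chartA hw).sqrt (chartA_pos hw).ne').prodMk
    ((hasFDerivAt_chartB hw).sqrt (chartB_pos hw).ne')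
  have h3 := h1.unique h2
  have hA := Real.sqrt_pos.2 (chartA_pos hw)
  have hB := Real.sqrt_pos.2 (chartB_pos hw)
  have ht : 0 < 1 + w.2 := by have := hw.1; linarith
  rw [tangentVectors_chart hw, ← Set.range_comp, Set.range_eq_univ]
  have h4 : ∀ v, Prod.fst (fderiv ℝ chart w v) = _ := fun v => congrArg (fun L => L v) h3
  -- The Jacobian determinant of (A, B) in (x, t). Passing to the square roots only scales the rows
  -- by positive factors.
  have h5 : -2 * w.1 / (1 + w.2) * ((1 - 3 * w.2 ^ 2 * w.1 ^ 2 - 2 * w.2 ^ 3 * w.1 ^ 2)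
      / (1 + w.2) ^ 2) - -(1 - w.1 ^ 2) / (1 + w.2) ^ 2 * (-2 * w.2 ^ 3 * w.1 / (1 + w.2))
      = -2 / (1 + w.2) ^ 2 * (w.1 * (1 - w.2 + w.2 ^ 2 - 3 * w.2 ^ 2 * w.1 ^ 2)) := by
    field_simp
    ring
  rw [← mul_ne_zero_iff, ← mul_ne_zero_iff_left (a := -2 / (1 + w.2) ^ 2)
    (div_ne_zero (by norm_num) (by positivity)), ← h5]
  generalize -2 * w.1 / (1 + w.2) = a at *
  generalize -(1 - w.1 ^ 2) / (1 + w.2) ^ 2 = b at *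
  generalize -2 * w.2 ^ 3 * w.1 / (1 + w.2) = c at *
  generalize (1 - 3 * w.2 ^ 2 * w.1 ^ 2 - 2 * w.2 ^ 3 * w.1 ^ 2) / (1 + w.2) ^ 2 = d at *
  have h6 : ∀ v, Prod.fst (fderiv ℝ chart w v) = (1 / (2 * √(chartA w)) * (a * v.1 + b * v.2),
    1 / (2 * √(chartB w)) * (c * v.1 + d * v.2)) := h4
  generalize √(chartA w) = p at *
  generalize √(chartB w) = q at *
  constructor
  · intro hs hdet
    obtain ⟨v, hv⟩ := hs (1, 0)
    obtain ⟨u, hu⟩ := hs (0, 1)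
    simp only [Function.comp_apply, h6, Prod.mk.injEq] at hv hu
    have v1 : a * v.1 + b * v.2 = 2 * p := by have := hv.1; field_simp at this; linarith
    have v2 : c * v.1 + d * v.2 = 0 := by have := hv.2; field_simp at this; linarith
    have u1 : a * u.1 + b * u.2 = 0 := by have := hu.1; field_simp at this; linarith
    have u2 : c * u.1 + d * u.2 = 2 * q := by have := hu.2; field_simp at this; linarith
    have : (2 * p) * (2 * q) = 0 := by
      linear_combination (-(2 * q)) * v1 - (a * v.1 + b * v.2) * u2 + (c * v.1 + d * v.2) * u1
        + (v.1 * u.2 - v.2 * u.1) * hdet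
    have : 0 < (2 * p) * (2 * q) := by positivity
    linarith
  · rintro hdet ⟨s, t⟩
    obtain ⟨e, he⟩ : ∃ e, e = a * d - b * c := ⟨_, rfl⟩
    rw [← he] at hdet
    refine ⟨((2 * p * s * d - 2 * q * t * b) / e, (2 * q * t * a - 2 * p * s * c) / e), ?_⟩
    simp only [Function.comp_apply, h6, Prod.mk.injEq]
    constructor <;> field_simp <;> rw [he] <;> ring

theorem isNondegenerate_chart_iff {w : ℝ × ℝ} (hw : w ∈ chartDom) :
    IsNondegenerate (chart w) ↔
      w.1 ≠ 0 ∧ 1 - w.2 + w.2 ^ 2 - 3 * w.2 ^ 2 * w.1 ^ 2 ≠ 0 := by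
  rw [IsNondegenerate, image_tangentVectors_eq_univ_iff hw]
  exact and_iff_right (chart_mem hw)

theorem isSingular_chart_iff {w : ℝ × ℝ} (hw : w ∈ chartDom) :
    IsSingular (chart w) ↔
      w.1 = 0 ∨ 1 - w.2 + w.2 ^ 2 - 3 * w.2 ^ 2 * w.1 ^ 2 = 0 := by
  rw [IsSingular, Ne, image_tangentVectors_eq_univ_iff hw, and_iff_right (chart_mem hw)]
  tauto

/-! ### Normal forms: folds and pleats -/

theorem exists_equiv_of_injective {L : ℝ × ℝ →L[ℝ] ℝ × ℝ} (h : Function.Injective L) :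
    ∃ e : (ℝ × ℝ) ≃L[ℝ] ℝ × ℝ, (e : ℝ × ℝ →L[ℝ] ℝ × ℝ) = L :=
  ⟨(LinearEquiv.ofInjectiveEndo (L : ℝ × ℝ →ₗ[ℝ] ℝ × ℝ) h).toContinuousLinearEquiv, rfl⟩

/-- Normal forms of the Lagrangian mapping can be read off in the global chart of `Λ^red` and the
coordinates `(y₁², y₂²)` of the target. -/
theorem hasNormalForm_of_coords {w : ℝ × ℝ} (hw : w ∈ chartDom) {f k ψ : ℝ × ℝ → ℝ × ℝ}
    {k' ψ' : ℝ × ℝ →L[ℝ] ℝ × ℝ} (hk : ContDiffAt ℝ ω k w) (hk0 : k w = 0)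
    (hk' : HasFDerivAt k k' w) (hki : Function.Injective k')
    (hψ : ContDiffAt ℝ ω ψ (chartA w, chartB w))
    (hψ' : HasFDerivAt ψ ψ' (chartA w, chartB w)) (hψi : Function.Injective ψ')
    (heq : ∀ᶠ z in 𝓝 w, ψ (chartA z, chartB z) = f (k z)) : HasNormalForm (chart w) f := by
  obtain ⟨e, rfl⟩ := exists_equiv_of_injective hki
  have hs := hk.hasStrictFDerivAt' hk' (by simp)
  -- The required parametrization is the chart precomposed with the local inverse of `k`.
  set l := hs.localInverse k e w with hl
  have hlc : ContDiffAt ℝ ω l 0 := by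
    rw [← hk0]
    exact hk.to_localInverse hk' (by simp)
  have hl0 : l 0 = w := by
    rw [← hk0]
    exact hs.localInverse_apply_image
  have hl' : HasFDerivAt l (e.symm : ℝ × ℝ →L[ℝ] ℝ × ℝ) 0 := by
    rw [← hk0]
    exact hs.to_localInverse.hasFDerivAt
  have hlt : Filter.Tendsto l (𝓝 0) (𝓝 w) := by
    have := hlc.continuousAt
    rwa [ContinuousAt, hl0] at this
  have hlr : ∀ᶠ z in 𝓝 (0 : ℝ × ℝ), k (l z) = z := by
    rw [← hk0]
    exact hs.eventually_right_inverse
  have hkt : Filter.Tendsto k (𝓝 w) (𝓝 0) := by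
    have := hk.continuousAt
    rwa [ContinuousAt, hk0] at this
  have hlm : Filter.map l (𝓝 0) = 𝓝 w := by
    refine le_antisymm hlt fun s hsm => ?_
    filter_upwards [hkt hsm, hs.eventually_left_inverse] with z h1 h2
    rw [← h2]
    exact h1
  have hdom : ∀ᶠ z in 𝓝 (0 : ℝ × ℝ), l z ∈ chartDom :=
    hlt (isOpen_chartDom.mem_nhds hw)
  have hc := differentiableAt_chart hw
  have hA := Real.sq_sqrt (chartA_pos hw).le
  have hB := Real.sq_sqrt (chartB_pos hw).le
  obtain ⟨hy1, hy2⟩ := chartProj_mem_torus hw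
  -- Squaring both coordinates has invertible derivative on the torus, so it may be absorbed into
  -- the target change of coordinates.
  let sq : ACoord → ℝ × ℝ := fun y => (y.1 ^ 2, y.2 ^ 2)
  have hsq : sq (chartProj w) = (chartA w, chartB w) := by simp [sq, chartProj, hA, hB]
  have hsqc : ContDiff ℝ ω sq := by fun_prop
  have hsq' : HasFDerivAt sq (((2 * (chartProj w).1) • ContinuousLinearMap.fst ℝ ℝ ℝ).prod
      ((2 * (chartProj w).2) • ContinuousLinearMap.snd ℝ ℝ ℝ)) (chartProj w) := by
    have h1 := (hasFDerivAt_fst (𝕜 := ℝ) (p := chartProj w)).pow 2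
    have h2 := (hasFDerivAt_snd (𝕜 := ℝ) (p := chartProj w)).pow 2
    simpa using h1.prodMk h2
  rw [← hsq] at hψ hψ'
  have hcomp := hψ'.comp (chartProj w) hsq'
  have hinj : Function.Injective (ψ'.comp (((2 * (chartProj w).1) •
      ContinuousLinearMap.fst ℝ ℝ ℝ).prod ((2 * (chartProj w).2) •
      ContinuousLinearMap.snd ℝ ℝ ℝ))) := by
    intro a b hab
    have := Prod.ext_iff.1 (hψi hab)
    simpa [Prod.ext_iff, hy1.ne', hy2.ne'] using this
  obtain ⟨e', he'⟩ := exists_equiv_of_injective hinj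
  rw [← he'] at hcomp
  refine ⟨chart_mem hw, chart ∘ l, (fderiv ℝ chart w).comp (e.symm : ℝ × ℝ →L[ℝ] ℝ × ℝ),
    ψ ∘ sq, e', by simp [hl0], ?_, ?_, ?_, ?_, ?_, hcomp, ?_⟩
  · filter_upwards [hdom, hlc.eventually (by simp)] with z h1 h2
    exact ((contDiffAt_chart h1).comp z h2).of_le le_top
  · have := hc.hasFDerivAt
    rw [← hl0] at this
    have h := this.comp 0 hl'
    rwa [hl0] at h
  · exact (fderiv_chart_injective hw).comp e.symm.injective
  · rw [← Filter.map_map, hlm, map_chart_nhds hw]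
  · filter_upwards [(hψ.comp (chartProj w) hsqc.contDiffAt).eventually (by simp)] with y h
    exact h.of_le le_top
  · filter_upwards [hdom, hlr, hlt heq] with z h1 h2 h3
    have h4 : sq (chartProj (l z)) = (chartA (l z), chartB (l z)) := by
      simp [sq, chartProj, Real.sq_sqrt (chartA_pos h1).le, Real.sq_sqrt (chartB_pos h1).le]
    change ψ (sq (chartProj (l z))) = f z
    rw [h4, h3, h2]

theorem covec_prod_injective {a b : ℝ × ℝ} (h : a.1 * b.2 - a.2 * b.1 ≠ 0) :
    Function.Injective ((covec a).prod (covec b)) := by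
  rw [injective_iff_map_eq_zero]
  intro v hv
  obtain ⟨h1, h2⟩ := Prod.ext_iff.1 hv
  simp only [ContinuousLinearMap.prod_apply, covec_apply, Prod.fst_zero, Prod.snd_zero] at h1 h2
  ext
  · refine (mul_eq_zero.1 ?_).resolve_left h
    linear_combination b.2 * h1 - a.2 * h2
  · refine (mul_eq_zero.1 ?_).resolve_left h
    linear_combination a.1 * h2 - b.1 * h1

/-- Substitute x² = 1 - A(1 + t) in the formula for B; the factor 1 + t cancels. -/
theorem chartB_eq {w : ℝ × ℝ} (hw : w ∈ chartDom) :
    chartB w = chartA w * w.2 ^ 3 - w.2 ^ 2 + w.2 := by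
  have : 1 + w.2 ≠ 0 := by have := hw.1; linarith
  rw [chartA, chartB]
  field_simp
  ring

/-- Where `x ≠ 0`, the Lagrangian mapping is `(A, t) ↦ (A, A t³ - t² + t)`, and normal forms can be
read off from triangular changes of coordinates. -/
theorem hasNormalForm_of_cubic {w : ℝ × ℝ} (hw : w ∈ chartDom) (hx : w.1 ≠ 0)
    {f : ℝ × ℝ → ℝ × ℝ} {k β : ℝ × ℝ → ℝ} {τ : ℝ → ℝ} {dk dβ dτ : ℝ}
    (hk : ContDiffAt ℝ ω k (chartA w, w.2)) (hβ : ContDiffAt ℝ ω β (chartA w, chartB w))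
    (hτ : ContDiffAt ℝ ω τ (chartA w)) (hk0 : k (chartA w, w.2) = 0) (hτ0 : τ (chartA w) = 0)
    (hdk : HasDerivAt (fun t => k (chartA w, t)) dk w.2) (hdk0 : dk ≠ 0)
    (hdβ : HasDerivAt (fun b => β (chartA w, b)) dβ (chartB w)) (hdβ0 : dβ ≠ 0)
    (hdτ : HasDerivAt τ dτ (chartA w)) (hdτ0 : dτ ≠ 0)
    (heq : ∀ᶠ q in 𝓝 (chartA w, w.2),
      (β (q.1, q.1 * q.2 ^ 3 - q.2 ^ 2 + q.2), τ q.1) = f (k q, τ q.1)) :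
    HasNormalForm (chart w) f := by
  have hA := contDiffAt_chartA hw
  have hA' := hasFDerivAt_chartA hw
  have hg : ContDiffAt ℝ ω (fun z : ℝ × ℝ => (chartA z, z.2)) w := hA.prodMk contDiffAt_snd
  have hk1 := (hk.differentiableAt (by simp)).hasFDerivAt
  have hk2 := hk1.comp w (hA'.prodMk hasFDerivAt_snd)
  have hβ1 := (hβ.differentiableAt (by simp)).hasFDerivAt
  have hτ1 : HasFDerivAt (fun z => τ (chartA z)) _ w := hdτ.comp_hasFDerivAt w hA'
  have ht : 1 + w.2 ≠ 0 := by have := hw.1; linarith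
  refine hasNormalForm_of_coords hw
    (k := fun z => (k (chartA z, z.2), τ (chartA z))) (ψ := fun q => (β q, τ q.1))
    ((hk.comp w hg).prodMk (hτ.comp w hA)) (by simp [hk0, hτ0]) (hk2.prodMk hτ1) ?_
    (hβ.prodMk (ContDiffAt.comp (chartA w, chartB w) (f := Prod.fst) hτ contDiffAt_fst))
    (hβ1.prodMk (HasDerivAt.comp_hasFDerivAt (f := Prod.fst) (chartA w, chartB w) hdτ
      hasFDerivAt_fst)) ?_ ?_
  -- The second component forces dA(v) = 0, then dk ≠ 0 forces the t-component to vanish; as ∂A/∂x =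
  -- -2x/(1 + t) ≠ 0, so does the x-component.
  · rw [injective_iff_map_eq_zero]
    intro v hv
    obtain ⟨h1, h2⟩ := Prod.ext_iff.1 hv
    have e2 := hk1.comp_hasDerivAt (f := fun t => (chartA w, t)) w.2
      ((hasDerivAt_const w.2 (chartA w)).prodMk (hasDerivAt_id w.2))
    have e3 := e2.unique hdk
    simp only [ContinuousLinearMap.prod_apply, smul_apply, Prod.snd_zero,
      smul_eq_mul, mul_eq_zero, hdτ0, false_or, ContinuousLinearMap.comp_apply, Prod.fst_zero,
      ContinuousLinearMap.coe_snd'] at h1 h2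
    rw [h2, show ((0, v.2) : ℝ × ℝ) = v.2 • (0, 1) by simp, map_smul, e3] at h1
    have hv2 : v.2 = 0 := by simpa [hdk0] using h1
    rw [covec_apply, hv2] at h2
    have hv1 : v.1 = 0 := by simpa [hx, ht] using h2
    exact Prod.ext hv1 hv2
  · rw [injective_iff_map_eq_zero]
    intro v hv
    obtain ⟨h1, h2⟩ := Prod.ext_iff.1 hv
    have e2 := hβ1.comp_hasDerivAt (f := fun t => (chartA w, t)) (chartB w)
      ((hasDerivAt_const (chartB w) (chartA w)).prodMk (hasDerivAt_id (chartB w)))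
    have e3 := e2.unique hdβ
    have hv1 : v.1 = 0 := by simpa [hdτ0] using h2
    have hv' : v = v.2 • (0, 1) := by ext <;> simp [hv1]
    simp only [ContinuousLinearMap.prod_apply, Prod.fst_zero] at h1
    rw [hv', map_smul, e3] at h1
    have hv2 : v.2 = 0 := by simpa [hdβ0] using h1
    exact Prod.ext hv1 hv2
  · filter_upwards [hg.continuousAt heq, isOpen_chartDom.mem_nhds hw] with z h1 h2
    rw [chartB_eq h2]
    exact h1

/-- Here 1 - A - B = (x√(1 - t + t²))² is already a square, and A completes it to coordinates
because ∂A/∂t ≠ 0 at x = 0. -/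
theorem isFoldPoint_of_fst_eq_zero {w : ℝ × ℝ} (hw : w ∈ chartDom) (hx : w.1 = 0) :
    IsFoldPoint (chart w) := by
  obtain ⟨x, t⟩ := w
  obtain rfl : x = 0 := hx
  have ht : 0 < t := hw.1
  have hpos : ∀ s : ℝ, 0 < 1 - s + s ^ 2 := fun s => by nlinarith [sq_nonneg (2 * s - 1)]
  have hc : ContDiffAt ℝ ω (fun z : ℝ × ℝ => z.1 * √(1 - z.2 + z.2 ^ 2)) (0, t) :=
    contDiffAt_fst.mul (ContDiffAt.sqrt (by fun_prop) (hpos _).ne')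
  have h1 : HasFDerivAt (fun z : ℝ × ℝ => z.1 * √(1 - z.2 + z.2 ^ 2))
      (covec (√(1 - t + t ^ 2), 0)) (0, t) := by
    refine hasFDerivAt_covec (hc.differentiableAt (by simp)) ?_ ?_
    · simpa using (hasDerivAt_id (0 : ℝ)).mul_const (√(1 - t + t ^ 2))
    · simpa using hasDerivAt_const t (0 : ℝ)
  have h2 := (hasFDerivAt_chartA hw).sub_const (chartA (0, t))
  refine hasNormalForm_of_coords hw
    (k := fun z => (z.1 * √(1 - z.2 + z.2 ^ 2), chartA z - chartA (0, t)))
    (ψ := fun q => (1 - q.1 - q.2, q.1 - chartA (0, t)))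
    (ψ' := (covec (-1, -1)).prod (covec (1, 0)))
    (hc.prodMk ((contDiffAt_chartA hw).sub contDiffAt_const)) (by simp)
    (h1.prodMk h2) (covec_prod_injective ?_) (by fun_prop) ?_
    (covec_prod_injective (by norm_num)) ?_
  · have := (Real.sqrt_pos.2 (hpos t)).ne'
    have : 1 + t ≠ 0 := by linarith
    simp
    exact ⟨by assumption, by assumption⟩
  · refine HasFDerivAt.prodMk (hasFDerivAt_covec (by fun_prop) ?_ ?_)
      (hasFDerivAt_covec (by fun_prop) ?_ ?_)
    · simpa using ((hasDerivAt_id (chartA (0, t))).const_sub 1).sub_const (chartB (0, t))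
    · simpa using (hasDerivAt_id (chartB (0, t))).const_sub (1 - chartA (0, t))
    · simpa using (hasDerivAt_id (chartA (0, t))).sub_const (chartA (0, t))
    · simpa using hasDerivAt_const (chartB (0, t)) (chartA (0, t) - chartA (0, t))
  · filter_upwards [isOpen_chartDom.mem_nhds hw] with z hz
    have h3 : 1 + z.2 ≠ 0 := by have := hz.1; linarith
    refine Prod.ext ?_ rfl
    simp only [mul_pow, Real.sq_sqrt (hpos z.2).le, chartA, chartB]
    field_simp
    ring

theorem isCuspPoint_of_chartA_eq {w : ℝ × ℝ} (hw : w ∈ chartDom) (hA : chartA w = 1 / 3)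
    (ht : w.2 = 1) : IsCuspPoint (chart w) := by
  have hx : w.1 ≠ 0 := by
    intro h
    rw [chartA, h, ht] at hA
    norm_num at hA
  -- Completing the cube: after division by A, the shift s = t - 1/(3A) turns the cubic into s³ +
  -- τ(A)s plus a function of A, which is moved into `β`. The constants are the derivatives at A =
  -- 1/3, t = 1.
  refine hasNormalForm_of_cubic hw hx (dk := 1) (dβ := 3) (dτ := 9)
    (k := fun q => q.2 - 1 / (3 * q.1)) (τ := fun a => (3 * a - 1) / (3 * a ^ 2))
    (β := fun q => (q.2 - 1 / (3 * q.1) + 2 / (27 * q.1 ^ 2)) / q.1) ?_ ?_ ?_ ?_ ?_ ?_ one_ne_zero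
    ?_ (by norm_num) ?_ (by norm_num) ?_
  all_goals rw [hA]; try rw [ht]
  · exact contDiffAt_snd.sub (contDiffAt_const.div (by fun_prop) (by norm_num))
  · exact ((contDiffAt_snd.sub (contDiffAt_const.div (by fun_prop) (by norm_num))).add
      (contDiffAt_const.div (by fun_prop) (by norm_num))).div contDiffAt_fst (by norm_num)
  · exact ContDiffAt.div (by fun_prop) (by fun_prop) (by norm_num)
  · norm_num
  · norm_num
  · exact (hasDerivAt_id' (1 : ℝ)).sub_const (1 / (3 * (1 / 3)))
  · have h := (((hasDerivAt_id' (chartB w)).sub_const (1 / (3 * (1 / 3)))).add_const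
      (2 / (27 * (1 / 3) ^ 2))).div_const (1 / 3)
    exact h.congr_deriv (by norm_num)
  · refine ((((hasDerivAt_id _).const_mul 3).sub_const 1).div
      (((hasDerivAt_id _).pow 2).const_mul 3) (by norm_num)).congr_deriv ?_
    norm_num
  · have : ∀ᶠ q : ℝ × ℝ in 𝓝 (1 / 3, 1), q.1 ≠ 0 :=
      continuousAt_fst.eventually_ne (by norm_num)
    filter_upwards [this] with q hq
    refine Prod.ext ?_ rfl
    simp only
    field_simp
    ring

/-- The critical point of `t ↦ a t³ - t² + t` at which the second derivative has the sign `e`. -/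
def critPt (e a : ℝ) : ℝ := (1 + e * √(1 - 3 * a)) / (3 * a)

theorem critPt_spec {e a : ℝ} (he : e ^ 2 = 1) (ha : a ≠ 0) (ha' : 3 * a ≤ 1) :
    3 * a * critPt e a ^ 2 - 2 * critPt e a + 1 = 0 := by
  have h := Real.sq_sqrt (show 0 ≤ 1 - 3 * a by linarith)
  rw [critPt]
  generalize √(1 - 3 * a) = s at *
  field_simp
  linear_combination s ^ 2 * he + h

theorem isFoldPoint_of_double_root {w : ℝ × ℝ} (hw : w ∈ chartDom) (hx : w.1 ≠ 0)
    (hA : 3 * chartA w ≠ 1) (ht : 3 * chartA w * w.2 ^ 2 - 2 * w.2 + 1 = 0) :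
    IsFoldPoint (chart w) := by
  have hA0 := chartA_pos hw
  generalize hAa : chartA w = a at *
  have ha' : 3 * a < 1 := by
    refine lt_of_le_of_ne ?_ hA
    nlinarith [sq_nonneg (3 * a * w.2 - 1)]
  have hs0 : 0 < √(1 - 3 * a) := Real.sqrt_pos.2 (by linarith)
  have hs := Real.sq_sqrt (show 0 ≤ 1 - 3 * a by linarith)
  -- The sign e records which critical point of the cubic, local minimum or maximum, the double root
  -- is.
  obtain ⟨e, he, hte⟩ : ∃ e : ℝ, e ^ 2 = 1 ∧ 3 * a * w.2 - 1 = e * √(1 - 3 * a) := by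
    have : (3 * a * w.2 - 1) ^ 2 = √(1 - 3 * a) ^ 2 := by rw [hs]; linear_combination 3 * a * ht
    rcases sq_eq_sq_iff_eq_or_eq_neg.1 this with h | h
    · exact ⟨1, by norm_num, by rw [h]; ring⟩
    · exact ⟨-1, by norm_num, by rw [h]; ring⟩
  have hct : critPt e a = w.2 := by
    rw [critPt, ← hte]
    field_simp
    ring
  have hcc : ContDiffAt ℝ ω (critPt e) a := by
    unfold critPt
    exact (contDiffAt_const.add (contDiffAt_const.mul (ContDiffAt.sqrt (by fun_prop)
      (by linarith)))).div (by fun_prop) (by positivity)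
  have hcf : ∀ b : ℝ, ContDiffAt ℝ ω (fun q : ℝ × ℝ => critPt e q.1) (a, b) := fun b =>
    ContDiffAt.comp (a, b) (f := Prod.fst) hcc contDiffAt_fst
  have hval : e * (a * (w.2 + 2 * critPt e a) - 1) = √(1 - 3 * a) := by
    rw [hct]
    linear_combination e * hte + √(1 - 3 * a) * he
  have he0 : e ≠ 0 := by rintro rfl; norm_num at he
  have hk : ContDiffAt ℝ ω (fun q : ℝ × ℝ => e * (q.1 * (q.2 + 2 * critPt e q.1) - 1))
      (a, w.2) := contDiffAt_const.mul ((contDiffAt_fst.mul (contDiffAt_snd.add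
        (contDiffAt_const.mul (hcf _)))).sub contDiffAt_const)
  -- With c the critical point and f(t) = A t³ - t² + t, one has f(t) - f(c) = (t - c)²(A(t + 2c) -
  -- 1). Times e, the last factor equals √(1 - 3a) > 0 at the base point, so it has a smooth square
  -- root.
  refine hasNormalForm_of_cubic hw hx (dk := √√(1 - 3 * a)) (dβ := e) (dτ := 1)
    (k := fun q => (q.2 - critPt e q.1) * √(e * (q.1 * (q.2 + 2 * critPt e q.1) - 1)))
    (β := fun q => e * (q.2 - (q.1 * critPt e q.1 ^ 3 - critPt e q.1 ^ 2 + critPt e q.1)))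
    (τ := fun b => b - a) ?_ ?_ ?_ ?_ ?_ ?_ (Real.sqrt_pos.2 hs0).ne' ?_ he0 ?_ one_ne_zero ?_
  all_goals rw [hAa]
  · exact (contDiffAt_snd.sub (hcf _)).mul (hk.sqrt (by simp only [hval]; exact hs0.ne'))
  · exact contDiffAt_const.mul (contDiffAt_snd.sub (((contDiffAt_fst.mul ((hcf _).pow 3)).sub
      ((hcf _).pow 2)).add (hcf _)))
  · fun_prop
  · simp [hct]
  · simp
  · have h1 : HasDerivAt (fun t => t - critPt e a) 1 w.2 := (hasDerivAt_id w.2).sub_const _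
    have h2 : DifferentiableAt ℝ (fun t => √(e * (a * (t + 2 * critPt e a) - 1))) w.2 :=
      DifferentiableAt.sqrt (by fun_prop) (by rw [hval]; exact hs0.ne')
    refine (h1.mul h2.hasDerivAt).congr_deriv ?_
    rw [hval, hct]
    ring
  · have h := ((hasDerivAt_id' (chartB w)).sub_const
      (a * critPt e a ^ 3 - critPt e a ^ 2 + critPt e a)).const_mul e
    exact h.congr_deriv (mul_one e)
  · exact (hasDerivAt_id' a).sub_const a
  · have h1 : ∀ᶠ q : ℝ × ℝ in 𝓝 (a, w.2), q.1 ≠ 0 := continuousAt_fst.eventually_ne hA0.ne'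
    have h2 : ∀ᶠ q : ℝ × ℝ in 𝓝 (a, w.2), 3 * q.1 < 1 :=
      ContinuousAt.eventually_lt (by fun_prop) continuousAt_const ha'
    have h3 : ∀ᶠ q : ℝ × ℝ in 𝓝 (a, w.2), 0 < e * (q.1 * (q.2 + 2 * critPt e q.1) - 1) :=
      continuousAt_const.eventually_lt hk.continuousAt (by simp only [hval]; exact hs0)
    filter_upwards [h1, h2, h3] with q k1 k2 k3
    refine Prod.ext ?_ rfl
    have h := critPt_spec he k1 k2.le
    simp only [mul_pow, Real.sq_sqrt k3.le]
    generalize critPt e q.1 = c at *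
    linear_combination e * (q.2 - c) * h

/-! ### Real roots of the cubic -/

/-- The cubic whose roots are the values of the chart coordinate `t` over `(√a, √b)`. -/
def cubic (a b t : ℝ) : ℝ := a * t ^ 3 - t ^ 2 + t - b

/-- The derivative of `cubic a b`. -/
def cubicDeriv (a t : ℝ) : ℝ := 3 * a * t ^ 2 - 2 * t + 1

/-- `1` minus the discriminant of `cubic a b`. -/
def codiscr (a b : ℝ) : ℝ := 27 * a ^ 2 * b ^ 2 - 18 * a * b + 4 * b + 4 * a

theorem causticPoly_eq (y : ACoord) : causticPoly y = codiscr (y.1 ^ 2) (y.2 ^ 2) := by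
  rw [causticPoly, codiscr]
  ring

theorem cubic_root_pos {a b t : ℝ} (ha : 0 < a) (hb : 0 < b) (h : cubic a b t = 0) : 0 < t := by
  by_contra! ht
  rw [cubic] at h
  have : 0 ≤ a * (-t) ^ 3 := mul_nonneg ha.le (pow_nonneg (by linarith) 3)
  nlinarith [sq_nonneg t]

theorem exists_cubic_root {a b : ℝ} (ha : 0 < a) (hb : 0 < b) : ∃ t, cubic a b t = 0 := by
  have hc : ContinuousOn (cubic a b) (Set.Icc 0 (1 / a + b)) := by
    unfold cubic
    fun_prop
  -- At the right endpoint T = 1/a + b one has aT - 1 = ab and T - b = 1/a, so the value is visibly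
  -- positive.
  obtain ⟨t, -, ht⟩ := intermediate_value_Icc (by positivity) hc
    (show (0 : ℝ) ∈ Set.Icc (cubic a b 0) (cubic a b (1 / a + b)) by
      refine ⟨by simp [cubic, hb.le], ?_⟩
      have : cubic a b (1 / a + b) = (1 / a + b) ^ 2 * (a * b) + 1 / a := by
        rw [cubic]
        field_simp
        ring
      rw [this]
      positivity)
  exact ⟨t, ht⟩

theorem cubic_factor {a b t : ℝ} (h : cubic a b t = 0) (s : ℝ) :
    cubic a b s = (s - t) * (a * (s * s) + (a * t - 1) * s + (a * t ^ 2 - t + 1)) := by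
  rw [cubic] at *
  linear_combination h

/-- The discriminant of a cubic is that of the quadratic cofactor of a root, times the square of the
cofactor at this root; that value is the derivative of the cubic there. -/
theorem one_sub_codiscr_eq {a b t : ℝ} (h : cubic a b t = 0) :
    1 - codiscr a b
      = discrim a (a * t - 1) (a * t ^ 2 - t + 1) * cubicDeriv a t ^ 2 := by
  obtain rfl : b = a * t ^ 3 - t ^ 2 + t := by rw [cubic] at h; linarith
  rw [codiscr, discrim, cubicDeriv]
  ring

theorem ncard_cubic_roots_of_lt {a b : ℝ} (ha : 0 < a) (hb : 0 < b) (h : codiscr a b < 1) :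
    {t | cubic a b t = 0}.ncard = 3 := by
  obtain ⟨t, ht⟩ := exists_cubic_root ha hb
  have hd := one_sub_codiscr_eq ht
  have hpos : 0 < discrim a (a * t - 1) (a * t ^ 2 - t + 1) * cubicDeriv a t ^ 2 := by linarith
  have h1 : 0 < discrim a (a * t - 1) (a * t ^ 2 - t + 1) := by
    by_contra! hn
    nlinarith [sq_nonneg (cubicDeriv a t)]
  have h2 : cubicDeriv a t ≠ 0 := by
    intro h0
    simp [h0] at hpos
  have hs := Real.sqrt_pos.2 h1
  have hss := (Real.mul_self_sqrt h1.le).symm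
  set s := √(discrim a (a * t - 1) (a * t ^ 2 - t + 1))
  have hq := quadratic_eq_zero_iff ha.ne' hss
  rw [Set.ncard_eq_three]
  have hne : ∀ r, a * (r * r) + (a * t - 1) * r + (a * t ^ 2 - t + 1) = 0 → t ≠ r := by
    rintro r hr rfl
    apply h2
    rw [cubicDeriv]
    linear_combination hr
  refine ⟨t, (-(a * t - 1) + s) / (2 * a), (-(a * t - 1) - s) / (2 * a),
    hne _ ((hq _).2 (Or.inl rfl)), hne _ ((hq _).2 (Or.inr rfl)), ?_, ?_⟩
  · intro he
    field_simp at he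
    linarith
  · ext r
    simp only [Set.mem_ofPred_eq, cubic_factor ht r, mul_eq_zero, sub_eq_zero, hq,
      Set.mem_insert_iff, Set.mem_singleton_iff]

theorem ncard_cubic_roots_of_gt {a b : ℝ} (ha : 0 < a) (hb : 0 < b) (h : 1 < codiscr a b) :
    {t | cubic a b t = 0}.ncard = 1 := by
  obtain ⟨t, ht⟩ := exists_cubic_root ha hb
  have hd := one_sub_codiscr_eq ht
  have h1 : discrim a (a * t - 1) (a * t ^ 2 - t + 1) < 0 := by
    by_contra! hn
    nlinarith [mul_nonneg hn (sq_nonneg (cubicDeriv a t))]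
  rw [Set.ncard_eq_one]
  refine ⟨t, ?_⟩
  ext r
  have hq := quadratic_ne_zero_of_discrim_ne_sq
    (fun s hs => by nlinarith [sq_nonneg s] :
      ∀ s, discrim a (a * t - 1) (a * t ^ 2 - t + 1) ≠ s ^ 2) r
  simp only [Set.mem_ofPred_eq, cubic_factor ht r, mul_eq_zero, sub_eq_zero, hq, or_false,
    Set.mem_singleton_iff]

theorem exists_double_root {a b : ℝ} (ha : 0 < a) (hb : 0 < b) (h : codiscr a b = 1) :
    ∃ t, cubic a b t = 0 ∧ cubicDeriv a t = 0 := by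
  obtain ⟨t, ht⟩ := exists_cubic_root ha hb
  have hd := one_sub_codiscr_eq ht
  rw [h, sub_self, eq_comm, mul_eq_zero] at hd
  rcases hd with hd | hd
  · have hq : a * (-(a * t - 1) / (2 * a) * (-(a * t - 1) / (2 * a)))
        + (a * t - 1) * (-(a * t - 1) / (2 * a)) + (a * t ^ 2 - t + 1) = 0 :=
      (quadratic_eq_zero_iff_of_discrim_eq_zero ha.ne' hd _).2 rfl
    have hr : 2 * a * (-(a * t - 1) / (2 * a)) = -(a * t - 1) := by field_simp
    refine ⟨-(a * t - 1) / (2 * a), ?_, ?_⟩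
    · rw [cubic_factor ht, hq, mul_zero]
    · rw [cubicDeriv]
      generalize -(a * t - 1) / (2 * a) = r at *
      linear_combination hq + (r - t) * hr
  · exact ⟨t, ht, pow_eq_zero_iff two_ne_zero |>.1 hd⟩

/-- The three roots sum to 1/a. -/
theorem cubic_roots_of_double_root {a b t : ℝ} (ha : 0 < a) (h : cubic a b t = 0)
    (h' : cubicDeriv a t = 0) : {s | cubic a b s = 0} = {t, 1 / a - 2 * t} := by
  ext s
  have : cubic a b s = a * ((s - t) ^ 2 * (s - (1 / a - 2 * t))) := by
    rw [cubic, cubicDeriv] at *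
    field_simp
    linear_combination h + (s - t) * h'
  simp only [Set.mem_ofPred_eq, this, mul_eq_zero, ha.ne', false_or, sub_eq_zero,
    pow_eq_zero_iff two_ne_zero, Set.mem_insert_iff, Set.mem_singleton_iff]

theorem eq_third_of_triple {a b t : ℝ} (h : cubic a b t = 0) (h' : cubicDeriv a t = 0)
    (ht : 3 * (a * t) = 1) : a = 1 / 3 ∧ b = 1 / 3 := by
  rw [cubic, cubicDeriv] at *
  have h1 : t = 1 := by linear_combination t * ht - h'
  subst h1
  exact ⟨by linarith, by linarith⟩

/-- Since `codiscr a b` - 1 = 3(3ab - 1)² + 4(a + b - 1), failure would give a + b = 1 and ab = 1/3,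
against ab ≤ 1/4. -/
theorem add_lt_one_of_codiscr_le {a b : ℝ} (ha : 0 < a) (hb : 0 < b) (h : codiscr a b ≤ 1) :
    a + b < 1 := by
  by_contra! hab
  rw [codiscr] at h
  have h1 : 3 * (3 * (a * b) - 1) ^ 2 + 4 * (a + b - 1) ≤ 0 := by linarith
  have h2 := sq_nonneg (3 * (a * b) - 1)
  have h3 : a + b = 1 := by linarith
  have h4 : (3 * (a * b) - 1) ^ 2 = 0 := by linarith
  have h5 : 3 * (a * b) = 1 := by
    have := pow_eq_zero_iff two_ne_zero |>.1 h4
    linarith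
  nlinarith [sq_nonneg (a - b)]

/-! ### Fibres of the Lagrangian mapping and the strata -/

/-- The inequalities defining the chart domain come for free over positive (a, b): roots are
positive, 1 - x² = a(1 + t), and t(1 - t²x²) = b(1 + t). -/
theorem chart_solution_iff {a b : ℝ} (ha : 0 < a) (hb : 0 < b) (w : ℝ × ℝ) :
    (w ∈ chartDom ∧ chartA w = a ∧ chartB w = b) ↔
      cubic a b w.2 = 0 ∧ w.1 ^ 2 = 1 - a * (1 + w.2) := by
  constructor
  · rintro ⟨hw, rfl, rfl⟩
    have : 1 + w.2 ≠ 0 := by have := hw.1; linarith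
    refine ⟨by rw [cubic, chartB_eq hw]; ring, ?_⟩
    rw [chartA]
    field_simp
    ring
  · rintro ⟨hc, hx⟩
    have ht := cubic_root_pos ha hb hc
    have h1 : 0 < a * (1 + w.2) := by positivity
    have h2 : 0 < b * (1 + w.2) := by positivity
    have hw : w ∈ chartDom := by
      refine ⟨ht, by linarith, ?_⟩
      have h3 : w.2 * (1 - (w.2 * w.1) ^ 2) = b * (1 + w.2) := by
        rw [cubic] at hc
        linear_combination (-w.2 ^ 3) * hx + (1 + w.2) * hc
      have := (mul_pos_iff_of_pos_left ht).1 (h3 ▸ h2)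
      linarith
    have hA : chartA w = a := by
      rw [chartA, hx]
      field_simp
      ring
    refine ⟨hw, hA, ?_⟩
    rw [chartB_eq hw, hA]
    rw [cubic] at hc
    linarith

/-- If 1 ≤ a(1 + t), the identity `h3` gives t ≤ b(1 + t); adding the two yields 1 ≤ a + b. Thus
inside the disc no root is lost and x never vanishes. -/
theorem one_sub_mul_pos_of_root {a b t : ℝ} (ha : 0 < a) (hb : 0 < b) (hab : a + b < 1)
    (h : cubic a b t = 0) : 0 < 1 - a * (1 + t) := by
  have ht := cubic_root_pos ha hb h
  by_contra! hn
  have h3 : t ^ 3 * (1 - a * (1 + t)) = t - b * (1 + t) := by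
    rw [cubic] at h
    linear_combination (-(1 + t)) * h
  have h4 : t ^ 3 * (1 - a * (1 + t)) ≤ 0 := mul_nonpos_of_nonneg_of_nonpos (by positivity) hn
  nlinarith

theorem chartA_add_chartB {w : ℝ × ℝ} (hw : w ∈ chartDom) :
    chartA w + chartB w = 1 - w.1 ^ 2 * (1 - w.2 + w.2 ^ 2) := by
  have : 1 + w.2 ≠ 0 := by have := hw.1; linarith
  rw [chartA, chartB]
  field_simp
  ring

/-- The points of the global chart over `(√a, √b)` whose second coordinate lies in `T`. -/
def chartPoints (a : ℝ) (T : Set ℝ) : Set (ℝ × ℝ) := {w | w.2 ∈ T ∧ w.1 ^ 2 = 1 - a * (1 + w.2)}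

theorem ncard_chartPoints {a : ℝ} {T : Set ℝ} (hT : ∀ t ∈ T, 0 < 1 - a * (1 + t)) :
    (chartPoints a T).ncard = 2 * T.ncard := by
  have h : chartPoints a T
      = (fun p : ℝ × ℝ => (p.1 * √(1 - a * (1 + p.2)), p.2)) '' (({1, -1} : Set ℝ) ×ˢ T) := by
    ext ⟨x, t⟩
    constructor
    · rintro ⟨ht, hx⟩
      have hs := Real.sq_sqrt (hT t ht).le
      rw [← hs] at hx
      rcases sq_eq_sq_iff_eq_or_eq_neg.1 hx with h | h
      · exact ⟨(1, t), ⟨by simp, ht⟩, by simpa using h.symm⟩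
      · exact ⟨(-1, t), ⟨by simp, ht⟩, by simpa using h.symm⟩
    · rintro ⟨⟨e, s⟩, ⟨he, hs⟩, hp⟩
      obtain ⟨rfl, rfl⟩ := Prod.ext_iff.1 hp
      refine ⟨hs, ?_⟩
      have he2 : e ^ 2 = 1 := by
        rcases he with rfl | rfl <;> norm_num
      simp only [mul_pow, he2, Real.sq_sqrt (hT s hs).le, one_mul]
  rw [h, Set.InjOn.ncard_image, Set.ncard_prod, Set.ncard_pair (by norm_num)]
  rintro ⟨e, s⟩ ⟨_, hs⟩ ⟨e', s'⟩ _ hp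
  simp only [Prod.mk.injEq] at hp
  obtain ⟨h1, rfl⟩ := hp
  have := (Real.sqrt_pos.2 (hT s hs)).ne'
  rw [mul_left_injective₀ this h1]

theorem fibre_eq_image {y : ACoord} (hy : y ∈ torus) :
    fibre y = chart '' chartPoints (y.1 ^ 2) {t | cubic (y.1 ^ 2) (y.2 ^ 2) t = 0} := by
  obtain ⟨h1, h2⟩ := hy
  have hs := chart_solution_iff (show 0 < y.1 ^ 2 by positivity) (show 0 < y.2 ^ 2 by positivity)
  ext p
  simp only [fibre, lagrangianRed_eq_image_chart, Set.mem_ofPred_eq]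
  constructor
  · rintro ⟨⟨w, hw, rfl⟩, he⟩
    exact ⟨w, (hs w).1 ⟨hw, (chartProj_eq_iff hw ⟨h1, h2⟩).1 he⟩, rfl⟩
  · rintro ⟨w, hw, rfl⟩
    obtain ⟨hd, he⟩ := (hs w).2 hw
    exact ⟨⟨w, hd, rfl⟩, (chartProj_eq_iff hd ⟨h1, h2⟩).2 he⟩

theorem ncard_image_chartPoints {y : ACoord} (hy : y ∈ torus) (hy' : y.1 ^ 2 + y.2 ^ 2 < 1)
    {T : Set ℝ} (hT : ∀ t ∈ T, cubic (y.1 ^ 2) (y.2 ^ 2) t = 0) :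
    (chart '' chartPoints (y.1 ^ 2) T).ncard = 2 * T.ncard := by
  obtain ⟨h1, h2⟩ := hy
  have ha : 0 < y.1 ^ 2 := by positivity
  have hb : 0 < y.2 ^ 2 := by positivity
  rw [Set.InjOn.ncard_image, ncard_chartPoints]
  · exact fun t ht => one_sub_mul_pos_of_root ha hb hy' (hT t ht)
  · exact chart_injOn.mono fun w hw => ((chart_solution_iff ha hb w).2 ⟨hT _ hw.1, hw.2⟩).1

theorem ncard_fibre {y : ACoord} (hy : y ∈ torus) (hy' : y.1 ^ 2 + y.2 ^ 2 < 1) :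
    (fibre y).ncard = 2 * {t | cubic (y.1 ^ 2) (y.2 ^ 2) t = 0}.ncard := by
  rw [fibre_eq_image hy, ncard_image_chartPoints (T := {t | _}) hy hy' fun _ => id]

theorem exists_mem_fibre {y : ACoord} (hy : y ∈ torus) (hy' : y.1 ^ 2 + y.2 ^ 2 < 1) {t : ℝ}
    (ht : cubic (y.1 ^ 2) (y.2 ^ 2) t = 0) :
    ∃ w ∈ chartDom, w.2 = t ∧ w.1 ^ 2 = 1 - y.1 ^ 2 * (1 + t) ∧ chartProj w = y := by
  obtain ⟨h1, h2⟩ := hy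
  have ha : 0 < y.1 ^ 2 := by positivity
  have hb : 0 < y.2 ^ 2 := by positivity
  have hp := one_sub_mul_pos_of_root ha hb hy' ht
  have hs := Real.sq_sqrt hp.le
  obtain ⟨hw, he⟩ := (chart_solution_iff ha hb (√(1 - y.1 ^ 2 * (1 + t)), t)).2 ⟨ht, hs⟩
  exact ⟨_, hw, rfl, hs, (chartProj_eq_iff hw ⟨h1, h2⟩).2 he⟩

theorem exists_mem_fibre_of_circle {y : ACoord} (hy : y ∈ torus) (hy' : y.1 ^ 2 + y.2 ^ 2 = 1) :
    ∃ w ∈ chartDom, w.1 = 0 ∧ chartProj w = y := by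
  obtain ⟨h1, h2⟩ := hy
  have ha : 0 < y.1 ^ 2 := by positivity
  have hb : 0 < y.2 ^ 2 := by positivity
  -- At x = 0 the chart gives A = 1/(1 + t) and B = t/(1 + t), hence t = B/A.
  obtain ⟨hw, he⟩ := (chart_solution_iff ha hb (0, y.2 ^ 2 / y.1 ^ 2)).2 (by
    have hb' : y.2 ^ 2 = 1 - y.1 ^ 2 := by linarith
    rw [cubic, hb']
    constructor <;> field_simp <;> ring)
  exact ⟨_, hw, rfl, (chartProj_eq_iff hw ⟨h1, h2⟩).2 he⟩

theorem mem_image_iff (y : ACoord) :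
    y ∈ Prod.fst '' lagrangianRed ↔ ∃ w ∈ chartDom, chartProj w = y := by
  rw [lagrangianRed_eq_image_chart, ← Set.image_comp]
  rfl

theorem chartProj_sq {w : ℝ × ℝ} (hw : w ∈ chartDom) :
    (chartProj w).1 ^ 2 = chartA w ∧ (chartProj w).2 ^ 2 = chartB w :=
  ⟨Real.sq_sqrt (chartA_pos hw).le, Real.sq_sqrt (chartB_pos hw).le⟩

theorem one_sub_add_sq_pos (t : ℝ) : 0 < 1 - t + t ^ 2 := by nlinarith [sq_nonneg (2 * t - 1)]

theorem image_eq : Prod.fst '' lagrangianRed = {y | y ∈ torus ∧ y.1 ^ 2 + y.2 ^ 2 ≤ 1} := by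
  ext y
  rw [mem_image_iff]
  constructor
  · rintro ⟨w, hw, rfl⟩
    refine ⟨chartProj_mem_torus hw, ?_⟩
    rw [(chartProj_sq hw).1, (chartProj_sq hw).2, chartA_add_chartB hw]
    have := mul_nonneg (sq_nonneg w.1) (one_sub_add_sq_pos w.2).le
    linarith
  · rintro ⟨hy, h⟩
    rcases h.lt_or_eq with h | h
    · obtain ⟨t, ht⟩ := exists_cubic_root (pow_pos hy.1 2) (pow_pos hy.2 2)
      obtain ⟨w, hw, -, -, he⟩ := exists_mem_fibre hy h ht
      exact ⟨w, hw, he⟩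
    · obtain ⟨w, hw, -, he⟩ := exists_mem_fibre_of_circle hy h
      exact ⟨w, hw, he⟩

theorem singular_factor {a : ℝ} {w : ℝ × ℝ} (h : w.1 ^ 2 = 1 - a * (1 + w.2)) :
    1 - w.2 + w.2 ^ 2 - 3 * w.2 ^ 2 * w.1 ^ 2 = (1 + w.2) * cubicDeriv a w.2 := by
  rw [h, cubicDeriv]
  ring

theorem isSingular_chart_iff_cubicDeriv {w : ℝ × ℝ} (hw : w ∈ chartDom) :
    IsSingular (chart w) ↔ w.1 = 0 ∨ cubicDeriv (chartA w) w.2 = 0 := by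
  have h := ((chart_solution_iff (chartA_pos hw) (chartB_pos hw) w).1 ⟨hw, rfl, rfl⟩).2
  have h' : 1 + w.2 ≠ 0 := by have := hw.1; linarith
  rw [isSingular_chart_iff hw, singular_factor h, mul_eq_zero, or_iff_right h']

theorem isNondegenerate_chart_iff_cubicDeriv {w : ℝ × ℝ} (hw : w ∈ chartDom) :
    IsNondegenerate (chart w) ↔ w.1 ≠ 0 ∧ cubicDeriv (chartA w) w.2 ≠ 0 := by
  have h := ((chart_solution_iff (chartA_pos hw) (chartB_pos hw) w).1 ⟨hw, rfl, rfl⟩).2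
  have h' : 1 + w.2 ≠ 0 := by have := hw.1; linarith
  rw [isNondegenerate_chart_iff hw, singular_factor h, mul_ne_zero_iff, and_iff_right h']

theorem caustic_eq :
    caustic = {y | y ∈ torus ∧ (y.1 ^ 2 + y.2 ^ 2 = 1 ∨ causticPoly y = 1)} := by
  ext y
  constructor
  · rintro ⟨p, hp, rfl⟩
    obtain ⟨hw, he⟩ := chart_chartInv hp.1
    rw [← he] at hp ⊢
    generalize chartInv p = w at *
    refine ⟨chartProj_mem_torus hw, ?_⟩
    rw [causticPoly_eq]
    change (chartProj w).1 ^ 2 + (chartProj w).2 ^ 2 = 1 ∨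
      codiscr ((chartProj w).1 ^ 2) ((chartProj w).2 ^ 2) = 1
    rw [(chartProj_sq hw).1, (chartProj_sq hw).2]
    rcases (isSingular_chart_iff_cubicDeriv hw).1 hp with h | h
    · left
      rw [chartA_add_chartB hw, h]
      ring
    · right
      have hc := ((chart_solution_iff (chartA_pos hw) (chartB_pos hw) w).1 ⟨hw, rfl, rfl⟩).1
      have := one_sub_codiscr_eq hc
      rw [h] at this
      linarith
  · rintro ⟨hy, h⟩
    rw [causticPoly_eq] at h
    have ha := pow_pos hy.1 2
    have hb := pow_pos hy.2 2
    rcases h with h | h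
    · obtain ⟨w, hw, h0, he⟩ := exists_mem_fibre_of_circle hy h
      exact ⟨chart w, (isSingular_chart_iff_cubicDeriv hw).2 (Or.inl h0), he⟩
    · obtain ⟨t, ht, ht'⟩ := exists_double_root ha hb h
      obtain ⟨w, hw, rfl, -, he⟩ := exists_mem_fibre hy (add_lt_one_of_codiscr_le ha hb h.le) ht
      refine ⟨chart w, (isSingular_chart_iff_cubicDeriv hw).2 (Or.inr ?_), he⟩
      rwa [((chartProj_eq_iff hw hy).1 he).1]

theorem aCusp_sq : aCusp.1 ^ 2 = 1 / 3 ∧ aCusp.2 ^ 2 = 1 / 3 := by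
  simp [aCusp]

theorem aCusp_mem_torus : aCusp ∈ torus := by
  constructor <;> simp [aCusp]

theorem causticPoly_aCusp : causticPoly aCusp = 1 := by
  rw [causticPoly_eq, aCusp_sq.1, aCusp_sq.2, codiscr]
  norm_num

theorem eq_aCusp {y : ACoord} (hy : y ∈ torus) (h1 : y.1 ^ 2 = 1 / 3) (h2 : y.2 ^ 2 = 1 / 3) :
    y = aCusp := by
  obtain ⟨c1, c2⟩ := aCusp_mem_torus
  refine Prod.ext ?_ ?_
  · exact (pow_left_inj₀ hy.1.le c1.le two_ne_zero).1 (h1.trans aCusp_sq.1.symm)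
  · exact (pow_left_inj₀ hy.2.le c2.le two_ne_zero).1 (h2.trans aCusp_sq.2.symm)

theorem add_sq_lt_one {y : ACoord} (hy : y ∈ torus) (h : causticPoly y ≤ 1) :
    y.1 ^ 2 + y.2 ^ 2 < 1 :=
  add_lt_one_of_codiscr_le (pow_pos hy.1 2) (pow_pos hy.2 2) (causticPoly_eq y ▸ h)

theorem shadow_eq : shadow = {y | y ∈ torus ∧ 1 < y.1 ^ 2 + y.2 ^ 2} := by
  ext y
  simp only [shadow, image_eq, Set.mem_sdiff, Set.mem_ofPred_eq, not_and, not_le]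
  exact ⟨fun h => ⟨h.1, h.2 h.1⟩, fun h => ⟨h.1, fun _ => h.2⟩⟩

theorem light_eq : light = L₁ ∪ L₂ := by
  ext y
  simp only [light, image_eq, caustic_eq, L₁, L₂, Set.mem_sdiff, Set.mem_union, Set.mem_ofPred_eq]
  constructor
  · rintro ⟨⟨hy, h1⟩, h2⟩
    have h3 : ¬ (y.1 ^ 2 + y.2 ^ 2 = 1 ∨ causticPoly y = 1) := fun h => h2 ⟨hy, h⟩
    rw [not_or] at h3
    rcases lt_or_gt_of_ne h3.2 with h | h
    · exact Or.inl ⟨hy, h⟩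
    · exact Or.inr ⟨hy, h, lt_of_le_of_ne h1 h3.1⟩
  · rintro (⟨hy, h⟩ | ⟨hy, h, h'⟩)
    · have h' := add_sq_lt_one hy h.le
      exact ⟨⟨hy, h'.le⟩, by rintro ⟨-, h1 | h1⟩ <;> linarith⟩
    · exact ⟨⟨hy, h'.le⟩, by rintro ⟨-, h1 | h1⟩ <;> linarith⟩

theorem caustic_eq_union : caustic = C₁ ∪ {aCusp} ∪ C₂ := by
  ext y
  simp only [caustic_eq, C₁, C₂, Set.mem_union, Set.mem_ofPred_eq, Set.mem_singleton_iff]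
  constructor
  · rintro ⟨hy, h | h⟩
    · exact Or.inl (Or.inl ⟨hy, h⟩)
    · by_cases hc : y = aCusp
      · exact Or.inl (Or.inr hc)
      · exact Or.inr ⟨hy, hc, h⟩
  · rintro ((⟨hy, h⟩ | rfl) | ⟨hy, -, h⟩)
    · exact ⟨hy, Or.inl h⟩
    · exact ⟨aCusp_mem_torus, Or.inr causticPoly_aCusp⟩
    · exact ⟨hy, Or.inr h⟩

theorem fibre_of_mem_C₁ {y : ACoord} (hy : y ∈ C₁) : ∃ p, fibre y = {p} ∧ IsFoldPoint p := by
  obtain ⟨hy, hc⟩ := hy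
  obtain ⟨w, hw, h0, he⟩ := exists_mem_fibre_of_circle hy hc
  refine ⟨chart w, ?_, isFoldPoint_of_fst_eq_zero hw h0⟩
  ext p
  simp only [Set.mem_singleton_iff]
  constructor
  · rintro ⟨hp, hpy⟩
    obtain ⟨hz, hze⟩ := chart_chartInv hp
    rw [← hze] at hpy ⊢
    generalize chartInv p = z at *
    have hz2 := (chartProj_eq_iff hz hy).1 hpy
    have hw2 := (chartProj_eq_iff hw hy).1 he
    have hz0 : z.1 = 0 := by
      have := chartA_add_chartB hz
      rw [hz2.1, hz2.2, hc] at this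
      have h3 : z.1 ^ 2 * (1 - z.2 + z.2 ^ 2) = 0 := by linarith
      simpa [(one_sub_add_sq_pos z.2).ne'] using h3
    have hA := hz2.1.trans hw2.1.symm
    have h1 : 1 + z.2 ≠ 0 := by have := hz.1; linarith
    have h2 : 1 + w.2 ≠ 0 := by have := hw.1; linarith
    rw [chartA, chartA, hz0, h0] at hA
    field_simp at hA
    rw [show z = w from Prod.ext (hz0.trans h0.symm) (by linarith)]
  · rintro rfl
    exact ⟨chart_mem hw, he⟩

theorem fibre_of_mem_C₂ {y : ACoord} (hy : y ∈ C₂) : (fibre y).ncard = 4 ∧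
    {p | p ∈ fibre y ∧ IsNondegenerate p}.ncard = 2 ∧
    {p | p ∈ fibre y ∧ IsSingular p ∧ IsFoldPoint p}.ncard = 2 := by
  obtain ⟨hy, hne, hc⟩ := hy
  have hlt := add_sq_lt_one hy hc.le
  rw [causticPoly_eq] at hc
  have ha := pow_pos hy.1 2
  have hb := pow_pos hy.2 2
  obtain ⟨t, ht, ht'⟩ := exists_double_root ha hb hc
  have hroots := cubic_roots_of_double_root ha ht ht'
  have htr : 3 * (y.1 ^ 2 * t) ≠ 1 := fun h => by
    obtain ⟨h1, h2⟩ := eq_third_of_triple ht ht' h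
    exact hne (eq_aCusp hy h1 h2)
  -- If 3A = 1, the derivative of the cubic is (t - 1)², so the double root would be triple.
  have hA3 : 3 * y.1 ^ 2 ≠ 1 := fun h => by
    apply htr
    rw [cubicDeriv, h] at ht'
    have : (t - 1) ^ 2 = 0 := by linear_combination ht'
    have : t = 1 := by
      have := pow_eq_zero_iff two_ne_zero |>.1 this
      linarith
    rw [this]
    linarith
  -- The remaining simple root; its two points are regular, and the two over `t` are the folds.
  obtain ⟨s, hs⟩ : ∃ s, s = 1 / y.1 ^ 2 - 2 * t := ⟨_, rfl⟩
  rw [← hs] at hroots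
  have hys : y.1 ^ 2 * s = 1 - 2 * (y.1 ^ 2 * t) := by
    rw [hs, mul_sub, mul_one_div_cancel ha.ne']
    ring
  have hts : t ≠ s := fun h => by
    rw [← h] at hys
    exact htr (by linarith)
  have hs0 : cubic (y.1 ^ 2) (y.2 ^ 2) s = 0 := by
    have : s ∈ {s | cubic (y.1 ^ 2) (y.2 ^ 2) s = 0} := by
      rw [hroots]
      simp
    exact this
  have hs' : cubicDeriv (y.1 ^ 2) s ≠ 0 := fun h => by
    rw [cubicDeriv] at h ht'
    have h1 : (s - t) * (1 - 3 * (y.1 ^ 2 * t)) = 0 := by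
      linear_combination h - ht' - 3 * (s - t) * hys
    rcases mul_eq_zero.1 h1 with h2 | h2
    · exact hts (by linarith)
    · exact htr (by linarith)
  have hmem : ∀ w ∈ chartPoints (y.1 ^ 2) {t | cubic (y.1 ^ 2) (y.2 ^ 2) t = 0},
      w ∈ chartDom ∧ w.1 ≠ 0 ∧ chartA w = y.1 ^ 2 := fun w hw => by
    obtain ⟨h1, h2, -⟩ := (chart_solution_iff ha hb w).2 hw
    refine ⟨h1, fun h0 => ?_, h2⟩
    have h3 := one_sub_mul_pos_of_root ha hb hlt hw.1
    have h4 := hw.2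
    rw [h0] at h4
    norm_num at h4
    linarith
  have hsub : ∀ r ∈ ({t, s} : Set ℝ), cubic (y.1 ^ 2) (y.2 ^ 2) r = 0 := fun r hr => by
    rw [← hroots] at hr
    exact hr
  refine ⟨?_, ?_, ?_⟩
  · rw [ncard_fibre hy hlt, hroots, Set.ncard_pair hts]
  · have : {p | p ∈ fibre y ∧ IsNondegenerate p} = chart '' chartPoints (y.1 ^ 2) {s} := by
      rw [fibre_eq_image hy]
      ext p
      constructor
      · rintro ⟨⟨w, hw, rfl⟩, hp⟩
        obtain ⟨h1, h2, h3⟩ := hmem w hw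
        rw [isNondegenerate_chart_iff_cubicDeriv h1, h3] at hp
        have hw2 := hw.1
        rw [hroots] at hw2
        refine ⟨w, ⟨hw2.resolve_left fun h => hp.2 (h ▸ ht'), hw.2⟩, rfl⟩
      · rintro ⟨w, ⟨hws, hw⟩, rfl⟩
        obtain rfl : w.2 = s := hws
        obtain ⟨h1, h2, h3⟩ := hmem w ⟨hs0, hw⟩
        refine ⟨⟨w, ⟨hs0, hw⟩, rfl⟩, ?_⟩
        rw [isNondegenerate_chart_iff_cubicDeriv h1, h3]
        exact ⟨h2, hs'⟩
    rw [this, ncard_image_chartPoints hy (T := {s}) hlt (fun r hr => hsub r (Or.inr hr)), Set.ncard_singleton]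
  · have : {p | p ∈ fibre y ∧ IsSingular p ∧ IsFoldPoint p}
        = chart '' chartPoints (y.1 ^ 2) {t} := by
      rw [fibre_eq_image hy]
      ext p
      constructor
      · rintro ⟨⟨w, hw, rfl⟩, hp, -⟩
        obtain ⟨h1, h2, h3⟩ := hmem w hw
        rw [isSingular_chart_iff_cubicDeriv h1, h3] at hp
        have hw2 := hw.1
        rw [hroots] at hw2
        refine ⟨w, ⟨hw2.resolve_right fun h => ?_, hw.2⟩, rfl⟩
        exact hs' (Set.mem_singleton_iff.1 h ▸ hp.resolve_left h2)
      · rintro ⟨w, ⟨hwt, hw⟩, rfl⟩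
        obtain rfl : w.2 = t := hwt
        obtain ⟨h1, h2, h3⟩ := hmem w ⟨ht, hw⟩
        refine ⟨⟨w, ⟨ht, hw⟩, rfl⟩, ?_, ?_⟩
        · rw [isSingular_chart_iff_cubicDeriv h1, h3]
          exact Or.inr ht'
        · exact isFoldPoint_of_double_root h1 h2 (by rwa [h3]) (by rw [h3]; exact ht')
    rw [this, ncard_image_chartPoints hy (T := {t}) hlt (fun r hr => hsub r (Or.inl hr)), Set.ncard_singleton]

theorem cubic_third_roots : {t | cubic (1 / 3) (1 / 3) t = 0} = {1} := by
  rw [cubic_roots_of_double_root (t := 1) (by norm_num) (by norm_num [cubic])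
    (by norm_num [cubicDeriv])]
  norm_num

theorem fibre_aCusp : (fibre aCusp).ncard = 2 ∧ ∀ p ∈ fibre aCusp, IsCuspPoint p := by
  have hlt := add_sq_lt_one aCusp_mem_torus causticPoly_aCusp.le
  constructor
  · rw [ncard_fibre aCusp_mem_torus hlt, aCusp_sq.1, aCusp_sq.2, cubic_third_roots,
      Set.ncard_singleton]
  · intro p hp
    rw [fibre_eq_image aCusp_mem_torus, aCusp_sq.1, aCusp_sq.2] at hp
    obtain ⟨w, hw, rfl⟩ := hp
    obtain ⟨h1, h2, -⟩ := (chart_solution_iff (by norm_num) (by norm_num) w).2 hw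
    refine isCuspPoint_of_chartA_eq h1 h2 ?_
    have := hw.1
    rwa [cubic_third_roots] at this

end

end PGL3Whittaker

theorem theorem7p1 :
    (shadow = {y | y ∈ torus ∧ 1 < y.1 ^ 2 + y.2 ^ 2}) ∧
    (light = L₁ ∪ L₂ ∧ Disjoint L₁ L₂) ∧
    (caustic = C₁ ∪ {aCusp} ∪ C₂ ∧
      Disjoint C₁ {aCusp} ∧ Disjoint C₁ C₂ ∧ Disjoint {aCusp} C₂) ∧
    (∀ y ∈ L₁, (fibre y).ncard = 6) ∧
    (∀ y ∈ L₂, (fibre y).ncard = 2) ∧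
    (∀ y ∈ C₁, ∃ p, fibre y = {p} ∧ IsFoldPoint p) ∧
    (∀ y ∈ C₂, (fibre y).ncard = 4 ∧
      {p | p ∈ fibre y ∧ IsNondegenerate p}.ncard = 2 ∧
      {p | p ∈ fibre y ∧ IsSingular p ∧ IsFoldPoint p}.ncard = 2) ∧
    ((fibre aCusp).ncard = 2 ∧ ∀ p ∈ fibre aCusp, IsCuspPoint p) := by
  refine ⟨shadow_eq, ⟨light_eq, ?_⟩, ⟨caustic_eq_union, ?_, ?_, ?_⟩, ?_, ?_,
    fun y => fibre_of_mem_C₁, fun y => fibre_of_mem_C₂, fibre_aCusp⟩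
  · exact Set.disjoint_left.2 fun y h1 h2 => lt_asymm h1.2 h2.2.1
  · refine Set.disjoint_left.2 ?_
    rintro y h1 rfl
    exact (add_sq_lt_one h1.1 causticPoly_aCusp.le).ne h1.2
  · exact Set.disjoint_left.2 fun y h1 h2 => (add_sq_lt_one h1.1 h2.2.2.le).ne h1.2
  · exact Set.disjoint_left.2 fun y h1 h2 => h2.2.1 h1
  · rintro y ⟨hy, h⟩
    rw [ncard_fibre hy (add_sq_lt_one hy h.le),
      ncard_cubic_roots_of_lt (pow_pos hy.1 2) (pow_pos hy.2 2) (causticPoly_eq y ▸ h)]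
  · rintro y ⟨hy, h, h'⟩
    rw [ncard_fibre hy h',
      ncard_cubic_roots_of_gt (pow_pos hy.1 2) (pow_pos hy.2 2) (causticPoly_eq y ▸ h)]
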